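/- Let $G$ be a finite simple graph with vertex set $V$, let $K$ be a field, and let $R = K[x : x \in V]$ be the polynomial ring whose indeterminates are the vertices of $G$. Let $I(G) \subseteq R$ be the edge ideal of $G$, i.e. the ideal generated by the products $xy$ such that $\{x,y\}$ is an edge of $G$. Denote by $\operatorname{ara} I(G)$ (arithmetical rank) the minimum number of elements of $R$ that generate an ideal whose radical is $I(G)$, and by $\operatorname{bight} I(G)$ (big height) the maximum height of the minimal primes of $I(G)$. Suppose that $G$ is a cactus graph, i.e. any two distinct cycles of $G$ (cycles being regarded as subgraphs) have at most one vertex in common, and let $n$ be the number of cycles of $G$. Then $$\operatorname{ara} I(G) \le \operatorname{bight} I(G) + n.$$ -/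

import Mathlib

/-- The arithmetical rank of an ideal `I`: the minimum number of ring elements that generate an
ideal whose radical is `I`. The infimum is taken in `ℕ∞`, so it is `⊤` if there are no such finite
families (in particular if `I` is not a radical ideal); edge ideals are radical. -/
noncomputable def Ideal.arithmeticalRank {R : Type*} [CommRing R] (I : Ideal R) : ℕ∞ :=
  ⨅ (s : Finset R) (_ : (Ideal.span (s : Set R)).radical = I), (s.card : ℕ∞)

/-- The big height of an ideal `I`: the maximum height of the minimal primes of `I`. -/
noncomputable def Ideal.bigHeight {R : Type*} [CommRing R] (I : Ideal R) : ℕ∞ :=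
  ⨆ P ∈ I.minimalPrimes, P.height

/-- The edge ideal of a graph `G` over `K`: the ideal of the polynomial ring whose indeterminates
are the vertices of `G`, generated by the products `x y` with `{x, y}` an edge of `G`. -/
noncomputable def SimpleGraph.edgeIdeal (K : Type*) [Field K] {V : Type*} (G : SimpleGraph V) :
    Ideal (MvPolynomial V K) :=
  Ideal.span {p | ∃ x y : V, G.Adj x y ∧ p = MvPolynomial.X x * MvPolynomial.X y}

/-- The set of cycles of `G`, each cycle being regarded as a subgraph of `G` (so that neither the
starting vertex nor the direction of a closed walk around the cycle matters). -/
def SimpleGraph.cycleSubgraphs {V : Type*} (G : SimpleGraph V) : Set G.Subgraph :=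
  {H | ∃ (v : V) (c : G.Walk v v), c.IsCycle ∧ c.toSubgraph = H}

/-- A cactus graph: any two distinct cycles have at most one vertex in common. -/
def SimpleGraph.IsCactus {V : Type*} (G : SimpleGraph V) : Prop :=
  ∀ C₁ ∈ G.cycleSubgraphs, ∀ C₂ ∈ G.cycleSubgraphs, C₁ ≠ C₂ → (C₁.verts ∩ C₂.verts).Subsingleton

/-! Complements of maximal independent sets are minimal vertex covers, and these generate minimal
primes of the edge ideal. So `maxCover` of the whole graph is at most the big height, and it
suffices to find `maxCover` + n elements of the ideal such that every prime containing them contains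
the ideal.

Induction on the edge set needs more, for every vertex z: all but `maxCover` of the graph without z,
plus n, of the elements are divisible by the variable z (`HasBoundedSystem`). Divisibility makes
gluing cheap: if the product of the variables z and y lies in a prime, so does one of the two
variables, with all its multiples. Lists of multiples of z and of y thus merge into symmetric sums,
as many as the longer list has elements (`exists_symmetric_system`).

If z is on no cycle, each edge zy is a bridge, and gluing its two sides costs one element plus the
larger of the two gains. This fits into `maxCover` (`IsBranch.le_maxCover`) unless one gain is 0 and
the other 1; then another branch at z, the degree of z, or passing from z to y helps.

If z is on a cycle, the cactus condition cuts the graph into parts hanging at the cycle's vertices.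
If some part has gain at most 1 at its vertex, a suitable cycle edge can be deleted without raising
`maxCover` (`maxCover_deleteEdge_le`); its generator is paid for by the destroyed cycle. If all
gains are at least 2, a cycle with k vertices is handled by k + 1 elements that also absorb one
element from each part (`HasSystem.cycle`), the others being merged over independent sets of cycle
vertices. `maxCover_biUnion_ge` pays for all but one of these elements, and the cycle pays for that
one. -/

namespace SimpleGraph

open scoped Classical
open MvPolynomial

variable {V : Type*}

/-! ### Edge ideals, vertex covers and primes generated by variables -/

section Algebra

variable {K : Type*} [Field K]

/-- The ideal is the kernel of the substitution that kills the variables in `D`. -/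
theorem isPrime_span_X_image (D : Set V) :
    (Ideal.span (X '' D : Set (MvPolynomial V K))).IsPrime := by
  let φ : MvPolynomial V K →ₐ[K] MvPolynomial V K := aeval fun v => if v ∈ D then 0 else X v
  have h1 : ∀ f, f - φ f ∈ Ideal.span (X '' D : Set (MvPolynomial V K)) := by
    intro f
    rw [← Ideal.Quotient.mk_eq_mk_iff_sub_mem]
    have : (Ideal.Quotient.mkₐ K (Ideal.span (X '' D : Set (MvPolynomial V K)))) =
        (Ideal.Quotient.mkₐ K (Ideal.span (X '' D : Set (MvPolynomial V K)))).comp φ := by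
      ext v
      by_cases hv : v ∈ D
      · have : (X v : MvPolynomial V K) ∈ Ideal.span (X '' D : Set (MvPolynomial V K)) :=
          Ideal.subset_span ⟨v, hv, rfl⟩
        simpa [φ, hv] using Ideal.Quotient.eq_zero_iff_mem.2 this
      · simp [φ, hv]
    exact congrArg (fun g => g f) this
  have h2 : Ideal.span (X '' D : Set (MvPolynomial V K)) = RingHom.ker φ := by
    apply le_antisymm
    · rw [Ideal.span_le]
      rintro _ ⟨v, hv, rfl⟩
      simp [φ, hv]
    · intro f hf
      have := h1 f
      rwa [RingHom.mem_ker.1 hf, sub_zero] at this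
  rw [h2]
  exact RingHom.ker_isPrime _

theorem X_mem_span_X_image {D : Set V} {v : V} :
    (X v : MvPolynomial V K) ∈ Ideal.span (X '' D : Set (MvPolynomial V K)) ↔ v ∈ D := by
  rw [mem_ideal_span_X_image]
  simp [support_X, Finsupp.single_apply]

theorem card_le_height_span_X_image (D : Finset V) :
    (D.card : ℕ∞) ≤ (Ideal.span (X '' (D : Set V) : Set (MvPolynomial V K))).height := by
  induction D using Finset.induction_on with
  | empty => simp
  | insert v D hv ih =>
    have := isPrime_span_X_image (K := K) (D : Set V)
    have := isPrime_span_X_image (K := K) ((insert v D : Finset V) : Set V)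
    have hlt : Ideal.span (X '' (D : Set V) : Set (MvPolynomial V K)) <
        Ideal.span (X '' ((insert v D : Finset V) : Set V)) := by
      refine lt_of_le_of_ne (Ideal.span_mono (Set.image_mono (by simp))) fun h => hv ?_
      have : (X v : MvPolynomial V K) ∈ Ideal.span (X '' (D : Set V)) := by
        rw [h]
        exact X_mem_span_X_image.2 (by simp)
      simpa using X_mem_span_X_image.1 this
    rw [Finset.card_insert_of_notMem hv]
    rw [Nat.cast_add, Nat.cast_one]
    exact le_trans (by gcongr) (Ideal.height_add_one_le_of_lt_of_isPrime hlt)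

variable (K) in
theorem edgeIdeal_le_iff {G : SimpleGraph V} {P : Ideal (MvPolynomial V K)} :
    G.edgeIdeal K ≤ P ↔ ∀ x y, G.Adj x y → (X x * X y : MvPolynomial V K) ∈ P := by
  rw [edgeIdeal, Ideal.span_le]
  constructor
  · exact fun h x y hxy => h ⟨x, y, hxy, rfl⟩
  · rintro h _ ⟨x, y, hxy, rfl⟩
    exact h x y hxy

theorem X_mul_X_mem_edgeIdeal {G : SimpleGraph V} {x y : V} (h : G.Adj x y) :
    (X x * X y : MvPolynomial V K) ∈ G.edgeIdeal K :=
  (edgeIdeal_le_iff K).1 le_rfl x y h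

theorem edgeIdeal_mono {G H : SimpleGraph V} (h : G ≤ H) : G.edgeIdeal K ≤ H.edgeIdeal K :=
  (edgeIdeal_le_iff K).2 fun _ _ hxy => X_mul_X_mem_edgeIdeal (h hxy)

theorem edgeIdeal_le_span_X_image {G : SimpleGraph V} {D : Set V}
    (hD : ∀ x y, G.Adj x y → x ∈ D ∨ y ∈ D) :
    G.edgeIdeal K ≤ Ideal.span (X '' D) := by
  refine (edgeIdeal_le_iff K).2 fun x y hxy => ?_
  rcases hD x y hxy with h | h
  · exact Ideal.mul_mem_right _ _ (X_mem_span_X_image.2 h)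
  · exact Ideal.mul_mem_left _ _ (X_mem_span_X_image.2 h)

/-- If no edge divides a monomial `m`, the vertices outside its support form a vertex cover. They
generate a prime containing the edge ideal, and `m` occurs in no element of that prime. -/
theorem edgeIdeal_isRadical (G : SimpleGraph V) : (G.edgeIdeal K).IsRadical := by
  intro f hf
  have hI : G.edgeIdeal K = Ideal.span ((fun s => monomial s (1 : K)) ''
      {s | ∃ x y, G.Adj x y ∧ s = Finsupp.single x 1 + Finsupp.single y 1}) := by
    rw [edgeIdeal]
    congr 1
    ext p
    constructor
    · rintro ⟨x, y, h, rfl⟩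
      exact ⟨_, ⟨x, y, h, rfl⟩, by simp [X, monomial_mul]⟩
    · rintro ⟨_, ⟨x, y, h, rfl⟩, rfl⟩
      exact ⟨x, y, h, by simp [X, monomial_mul]⟩
  rw [hI, mem_ideal_span_monomial_image]
  intro m hm
  by_contra hcon
  have hD : ∀ x y, G.Adj x y → x ∈ {v | m v = 0} ∨ y ∈ {v | m v = 0} := by
    intro x y hxy
    by_contra h
    simp only [Set.mem_ofPred_eq, not_or] at h
    refine hcon ⟨_, ⟨x, y, hxy, rfl⟩, fun v => ?_⟩
    have := hxy.ne
    simp only [Finsupp.add_apply, Finsupp.single_apply]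
    split_ifs with h1 h2 h2
    · exact absurd (h1.trans h2.symm) this
    · subst h1; omega
    · subst h2; omega
    · omega
  have hp := isPrime_span_X_image (K := K) {v | m v = 0}
  have := hp.radical_le_iff.2 (edgeIdeal_le_span_X_image (K := K) hD) hf
  obtain ⟨i, hi, hi'⟩ := mem_ideal_span_X_image.1 this m hm
  exact hi' hi

theorem arithmeticalRank_edgeIdeal_le {G : SimpleGraph V} {A : List (MvPolynomial V K)}
    (hA : ∀ f ∈ A, f ∈ G.edgeIdeal K)
    (h : ∀ P : Ideal (MvPolynomial V K), P.IsPrime → (∀ f ∈ A, f ∈ P) → G.edgeIdeal K ≤ P) :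
    (G.edgeIdeal K).arithmeticalRank ≤ (A.length : ℕ∞) := by
  have hr : (Ideal.span ((A.toFinset : Finset (MvPolynomial V K)) :
      Set (MvPolynomial V K))).radical = G.edgeIdeal K := by
    apply le_antisymm
    · refine ((edgeIdeal_isRadical G).radical_le_iff).2 (Ideal.span_le.2 fun f hf => hA f ?_)
      simpa using hf
    · rw [Ideal.radical_eq_sInf]
      refine le_sInf fun P hP => h P hP.2 fun f hf => hP.1 (Ideal.subset_span ?_)
      simpa using hf
  refine le_trans (iInf₂_le A.toFinset hr) ?_
  exact_mod_cast A.toFinset_card_le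

/-- Each vertex of `D` has an edge leaving `D`, which forces its variable into every prime between
the edge ideal and the span of `D`. -/
theorem card_le_bigHeight_edgeIdeal {G : SimpleGraph V} {D : Finset V}
    (hD : ∀ x y, G.Adj x y → x ∈ D ∨ y ∈ D) (hmin : ∀ x ∈ D, ∃ y ∉ D, G.Adj x y) :
    (D.card : ℕ∞) ≤ (G.edgeIdeal K).bigHeight := by
  have hp := isPrime_span_X_image (K := K) (D : Set V)
  refine (card_le_height_span_X_image (K := K) D).trans (le_iSup₂_of_le
    (Ideal.span (X '' (D : Set V))) ⟨⟨hp, edgeIdeal_le_span_X_image (by simpa using hD)⟩, ?_⟩ le_rfl)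
  rintro Q ⟨hQ, hIQ⟩ hQP
  rw [Ideal.span_le]
  rintro _ ⟨v, hv, rfl⟩
  obtain ⟨y, hy, hvy⟩ := hmin v hv
  refine (hQ.mem_or_mem (hIQ (X_mul_X_mem_edgeIdeal hvy))).resolve_right fun h => hy ?_
  simpa using X_mem_span_X_image.1 (hQP h)

end Algebra

/-! ### Maximal independent sets and the largest minimal vertex cover -/

section MaximalIndependent

/-- `S` is a maximal independent set of the subgraph of `G` induced on `W`. -/
def IsMaxIndep (G : SimpleGraph V) (W S : Finset V) : Prop :=
  S ⊆ W ∧ (∀ x ∈ S, ∀ y ∈ S, ¬ G.Adj x y) ∧ ∀ x ∈ W, x ∉ S → ∃ y ∈ S, G.Adj x y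

theorem indep_insert {G : SimpleGraph V} {S : Finset V} {z : V}
    (hS : ∀ x ∈ S, ∀ y ∈ S, ¬ G.Adj x y) (hz : ∀ y ∈ S, ¬ G.Adj z y) :
    ∀ x ∈ insert z S, ∀ y ∈ insert z S, ¬ G.Adj x y := by
  simp only [Finset.mem_insert]
  rintro a (rfl | ha) b (rfl | hb)
  · exact G.irrefl
  · exact hz b hb
  · exact fun h => hz a ha h.symm
  · exact hS a ha b hb

theorem exists_isMaxIndep_superset (G : SimpleGraph V) {W S : Finset V} (hS : S ⊆ W)
    (hi : ∀ x ∈ S, ∀ y ∈ S, ¬ G.Adj x y) : ∃ T, S ⊆ T ∧ G.IsMaxIndep W T := by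
  have hne : ((W.powerset).filter fun T => S ⊆ T ∧ ∀ x ∈ T, ∀ y ∈ T, ¬ G.Adj x y).Nonempty :=
    ⟨S, by simp [hS]; exact hi⟩
  obtain ⟨T, hT, hmax⟩ := Finset.exists_max_image _ Finset.card hne
  simp only [Finset.mem_filter, Finset.mem_powerset] at hT hmax
  refine ⟨T, hT.2.1, hT.1, hT.2.2, fun x hx hxT => ?_⟩
  by_contra! hcon
  have := hmax (insert x T) ⟨Finset.insert_subset hx hT.1, hT.2.1.trans (Finset.subset_insert _ _),
    indep_insert hT.2.2 hcon⟩
  rw [Finset.card_insert_of_notMem hxT] at this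
  omega

/-- The largest number of vertices of a minimal vertex cover of the subgraph of `G` induced
on `W`. -/
noncomputable def maxCover (G : SimpleGraph V) (W : Finset V) : ℕ :=
  (W.powerset.filter (G.IsMaxIndep W)).sup fun S => (W \ S).card

variable {G : SimpleGraph V} {W X Y S T : Finset V} {z y : V}

theorem IsMaxIndep.card_le (h : G.IsMaxIndep W S) : (W \ S).card ≤ G.maxCover W :=
  Finset.le_sup (f := fun S => (W \ S).card) (by simp [h, h.1])

theorem exists_isMaxIndep_card (G : SimpleGraph V) (W : Finset V) :
    ∃ S, G.IsMaxIndep W S ∧ (W \ S).card = G.maxCover W := by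
  obtain ⟨T, -, hT⟩ := G.exists_isMaxIndep_superset (W := W) (S := ∅) (by simp) (by simp)
  obtain ⟨S, hS, h⟩ := Finset.exists_mem_eq_sup (W.powerset.filter (G.IsMaxIndep W))
    ⟨T, by simp [hT, hT.1]⟩ fun S => (W \ S).card
  exact ⟨S, by simpa using (Finset.mem_filter.1 hS).2, h.symm⟩

theorem maxCover_le {n : ℕ} (h : ∀ S, G.IsMaxIndep W S → (W \ S).card ≤ n) :
    G.maxCover W ≤ n := by
  obtain ⟨S, hS, hc⟩ := G.exists_isMaxIndep_card W
  exact hc ▸ h S hS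

theorem card_sdiff_erase_of_notMem (hz : z ∈ W) (hS : z ∉ S) :
    (W \ S).card = (W.erase z \ S).card + 1 := by
  rw [Finset.erase_sdiff_comm, Finset.card_erase_add_one (by simp [hz, hS])]

theorem IsMaxIndep.of_erase_dominated (hS : G.IsMaxIndep (W.erase z) S)
    (hd : ∃ y ∈ S, G.Adj z y) : G.IsMaxIndep W S := by
  refine ⟨hS.1.trans (Finset.erase_subset _ _), hS.2.1, fun x hx hxS => ?_⟩
  by_cases hxz : x = z
  · exact hxz ▸ hd
  · exact hS.2.2 x (by simp [hx, hxz]) hxS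

theorem IsMaxIndep.insert_of_erase (hz : z ∈ W) (hS : G.IsMaxIndep (W.erase z) S)
    (hd : ∀ y ∈ S, ¬ G.Adj z y) :
    G.IsMaxIndep W (insert z S) ∧ (W \ insert z S).card = (W.erase z \ S).card := by
  refine ⟨⟨Finset.insert_subset hz (hS.1.trans (Finset.erase_subset _ _)),
    indep_insert hS.2.1 hd, fun x hx hxS => ?_⟩, ?_⟩
  · simp only [Finset.mem_insert, not_or] at hxS
    obtain ⟨y, hy, hxy⟩ := hS.2.2 x (by simp [hx, hxS.1]) hxS.2
    exact ⟨y, by simp [hy], hxy⟩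
  · congr 1
    ext x
    simp only [Finset.mem_sdiff, Finset.mem_erase, Finset.mem_insert]
    tauto

/-- A maximal independent set of `W.erase z` either dominates `z`, which then joins the cover, or
can be enlarged by `z` with the same cover. -/
theorem maxCover_erase_le (G : SimpleGraph V) (W : Finset V) (z : V) :
    G.maxCover (W.erase z) ≤ G.maxCover W := by
  by_cases hz : z ∈ W
  swap
  · rw [Finset.erase_eq_of_notMem hz]
  refine maxCover_le fun S hS => ?_
  by_cases hd : ∃ y ∈ S, G.Adj z y
  · have h1 := (hS.of_erase_dominated hd).card_le
    rw [card_sdiff_erase_of_notMem hz fun h => by simpa using hS.1 h] at h1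
    omega
  · push Not at hd
    obtain ⟨h1, h2⟩ := hS.insert_of_erase hz hd
    exact h2 ▸ h1.card_le

/-- The growth of `maxCover` when the vertex `z` is added. -/
noncomputable def gain (G : SimpleGraph V) (W : Finset V) (z : V) : ℕ :=
  G.maxCover W - G.maxCover (W.erase z)

theorem maxCover_erase_add_gain (G : SimpleGraph V) (W : Finset V) (z : V) :
    G.maxCover (W.erase z) + G.gain W z = G.maxCover W := by
  have := G.maxCover_erase_le W z
  unfold gain
  omega

theorem IsMaxIndep.erase (h : G.IsMaxIndep W S) (hz : z ∉ S) : G.IsMaxIndep (W.erase z) S :=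
  ⟨fun _ hx => Finset.mem_erase.2 ⟨fun e => hz (e ▸ hx), h.1 hx⟩, h.2.1,
    fun _ hx hxS => h.2.2 _ (Finset.mem_of_mem_erase hx) hxS⟩

/-- An optimal set avoiding `z` stays maximal in `W.erase z` with a cover only one smaller, so the
gain would be at most 1. -/
theorem exists_isMaxIndep_mem (hz : z ∈ W) (h : 2 ≤ G.gain W z) :
    ∃ S, G.IsMaxIndep W S ∧ z ∈ S ∧ (W \ S).card = G.maxCover W := by
  obtain ⟨S, hS, hc⟩ := G.exists_isMaxIndep_card W
  refine ⟨S, hS, ?_, hc⟩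
  by_contra hzS
  have h1 := (hS.erase hzS).card_le
  rw [card_sdiff_erase_of_notMem hz hzS] at hc
  unfold gain at h
  omega

/-- If `z` does not increase `maxCover`, then it lies in some optimal maximal independent set. -/
theorem exists_isMaxIndep_mem_of_gain_eq_zero (hz : z ∈ W) (h : G.gain W z = 0) :
    ∃ S, G.IsMaxIndep W S ∧ z ∈ S ∧ (W \ S).card = G.maxCover W := by
  obtain ⟨S, hS, hc⟩ := G.exists_isMaxIndep_card (W.erase z)
  have hm := G.maxCover_erase_add_gain W z
  have hzS : z ∉ S := fun h => by simpa using hS.1 h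
  -- If `S` dominated `z`, it would be maximal in `W` with `z` added to the cover, and the gain
  -- would be positive.
  have hd : ∀ y ∈ S, ¬ G.Adj z y := by
    by_contra! hd
    have h1 := (hS.of_erase_dominated hd).card_le
    rw [card_sdiff_erase_of_notMem hz hzS] at h1
    omega
  obtain ⟨h1, h2⟩ := hS.insert_of_erase hz hd
  exact ⟨_, h1, by simp, by omega⟩

theorem card_sdiff_union (hXY : Disjoint X Y) (hS : S ⊆ X) (hT : T ⊆ Y) :
    ((X ∪ Y) \ (S ∪ T)).card = (X \ S).card + (Y \ T).card := by
  rw [← Finset.card_union_of_disjoint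
    (hXY.mono Finset.sdiff_subset Finset.sdiff_subset)]
  congr 1
  ext x
  have h1 : x ∈ X → x ∉ Y := fun h => Finset.disjoint_left.1 hXY h
  have h2 := @hS x
  have h3 := @hT x
  simp only [Finset.mem_sdiff, Finset.mem_union]
  tauto

theorem card_sdiff_exchange (hX : X ⊆ W) (hS : S ⊆ W) (hT : T ⊆ X) :
    (W \ ((S \ X) ∪ T)).card + (X \ (S ∩ X)).card = (W \ S).card + (X \ T).card := by
  have hd : Disjoint (W \ X) X := Finset.sdiff_disjoint
  have hSX : S \ X ⊆ W \ X := Finset.sdiff_subset_sdiff hS le_rfl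
  have h1 := card_sdiff_union hd hSX hT
  have h2 := card_sdiff_union hd hSX (Finset.inter_subset_right (s₁ := S) (s₂ := X))
  rw [Finset.sdiff_union_of_subset hX] at h1 h2
  rw [Finset.sdiff_union_inter] at h2
  omega

theorem maxCover_union (hXY : Disjoint X Y) (h : ∀ x ∈ X, ∀ y ∈ Y, ¬ G.Adj x y) :
    G.maxCover (X ∪ Y) = G.maxCover X + G.maxCover Y := by
  apply le_antisymm
  · refine maxCover_le fun S hS => ?_
    have hX : G.IsMaxIndep X (S ∩ X) := by
      refine ⟨Finset.inter_subset_right, fun x hx y hy => hS.2.1 x (Finset.mem_inter.1 hx).1 y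
        (Finset.mem_inter.1 hy).1, fun x hx hxS => ?_⟩
      obtain ⟨y, hy, hxy⟩ := hS.2.2 x (by simp [hx]) (fun h => hxS (by simp [h, hx]))
      refine ⟨y, Finset.mem_inter.2 ⟨hy, ?_⟩, hxy⟩
      exact (Finset.mem_union.1 (hS.1 hy)).resolve_right fun hy' => h x hx y hy' hxy
    have hY : G.IsMaxIndep Y (S ∩ Y) := by
      refine ⟨Finset.inter_subset_right, fun x hx y hy => hS.2.1 x (Finset.mem_inter.1 hx).1 y
        (Finset.mem_inter.1 hy).1, fun x hx hxS => ?_⟩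
      obtain ⟨y, hy, hxy⟩ := hS.2.2 x (by simp [hx]) (fun h => hxS (by simp [h, hx]))
      refine ⟨y, Finset.mem_inter.2 ⟨hy, ?_⟩, hxy⟩
      exact (Finset.mem_union.1 (hS.1 hy)).resolve_left fun hy' => h y hy' x hx hxy.symm
    have := card_sdiff_union hXY hX.1 hY.1
    rw [← Finset.inter_union_distrib_left, Finset.inter_eq_left.2 hS.1] at this
    rw [this]
    exact add_le_add hX.card_le hY.card_le
  · obtain ⟨S, hS, hSc⟩ := G.exists_isMaxIndep_card X
    obtain ⟨T, hT, hTc⟩ := G.exists_isMaxIndep_card Y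
    rw [← hSc, ← hTc, ← card_sdiff_union hXY hS.1 hT.1]
    apply IsMaxIndep.card_le
    refine ⟨Finset.union_subset_union hS.1 hT.1, ?_, ?_⟩
    · intro a ha b hb
      rcases Finset.mem_union.1 ha with ha | ha <;> rcases Finset.mem_union.1 hb with hb | hb
      · exact hS.2.1 a ha b hb
      · exact h a (hS.1 ha) b (hT.1 hb)
      · exact fun hab => h b (hS.1 hb) a (hT.1 ha) hab.symm
      · exact hT.2.1 a ha b hb
    · intro x hx hxS
      simp only [Finset.mem_union, not_or] at hx hxS
      rcases hx with hx | hx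
      · obtain ⟨y, hy, hxy⟩ := hS.2.2 x hx hxS.1
        exact ⟨y, by simp [hy], hxy⟩
      · obtain ⟨y, hy, hxy⟩ := hT.2.2 x hx hxS.2
        exact ⟨y, by simp [hy], hxy⟩

/-- Gluing along a single edge `zy`, with `z` chosen. -/
theorem IsMaxIndep.bridge_le (hXY : Disjoint X Y) (hy : y ∈ Y) (hzy : G.Adj z y)
    (h : ∀ a ∈ X, ∀ b ∈ Y, G.Adj a b → a = z ∧ b = y) (hS : G.IsMaxIndep X S) (hzS : z ∈ S) :
    (X \ S).card + 1 + G.maxCover (Y.erase y) ≤ G.maxCover (X ∪ Y) := by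
  obtain ⟨T, hT, hTc⟩ := G.exists_isMaxIndep_card (Y.erase y)
  have hyT : y ∉ T := fun h => by simpa using hT.1 h
  have hTY : T ⊆ Y := hT.1.trans (Finset.erase_subset _ _)
  have h1 := card_sdiff_union hXY hS.1 hTY
  rw [card_sdiff_erase_of_notMem hy hyT, hTc] at h1
  have : G.IsMaxIndep (X ∪ Y) (S ∪ T) := by
    refine ⟨Finset.union_subset_union hS.1 hTY, ?_, ?_⟩
    · intro a ha b hb
      rcases Finset.mem_union.1 ha with ha | ha <;> rcases Finset.mem_union.1 hb with hb | hb
      · exact hS.2.1 a ha b hb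
      · exact fun hab => hyT ((h a (hS.1 ha) b (hTY hb) hab).2 ▸ hb)
      · exact fun hab => hyT ((h b (hS.1 hb) a (hTY ha) hab.symm).2 ▸ ha)
      · exact hT.2.1 a ha b hb
    · intro x hx hxS
      simp only [Finset.mem_union, not_or] at hx hxS
      rcases hx with hx | hx
      · obtain ⟨y, hy, hxy⟩ := hS.2.2 x hx hxS.1
        exact ⟨y, by simp [hy], hxy⟩
      · by_cases hxy : x = y
        · exact ⟨z, by simp [hzS], hxy ▸ hzy.symm⟩
        · obtain ⟨y, hy, hxy⟩ := hT.2.2 x (by simp [hx, hxy]) hxS.2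
          exact ⟨y, by simp [hy], hxy⟩
  have := this.card_le
  omega

/-- If `y` is worthwhile on its side, then so it is after gluing along an edge `zy`. -/
theorem gain_pos_of_bridge (hXY : Disjoint X Y) (hy : y ∈ Y) (hzy : G.Adj z y)
    (h : ∀ a ∈ X, ∀ b ∈ Y, G.Adj a b → a = z ∧ b = y) (hg : 0 < G.gain Y y) :
    G.maxCover X + G.maxCover (Y.erase y) + 1 ≤ G.maxCover (X ∪ Y) := by
  obtain ⟨S, hS, hSc⟩ := G.exists_isMaxIndep_card X
  -- If `z` is chosen it dominates `y`, so an optimum of `Y.erase y` can be used; otherwise optima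
  -- of both sides glue without interaction.
  by_cases hzS : z ∈ S
  · have := hS.bridge_le hXY hy hzy h hzS
    omega
  have hm := G.maxCover_erase_add_gain Y y
  obtain ⟨T, hT, hTc⟩ := G.exists_isMaxIndep_card Y
  have h1 := card_sdiff_union hXY hS.1 hT.1
  have : G.IsMaxIndep (X ∪ Y) (S ∪ T) := by
    refine ⟨Finset.union_subset_union hS.1 hT.1, ?_, ?_⟩
    · intro a ha b hb
      rcases Finset.mem_union.1 ha with ha | ha <;> rcases Finset.mem_union.1 hb with hb | hb
      · exact hS.2.1 a ha b hb
      · exact fun hab => hzS ((h a (hS.1 ha) b (hT.1 hb) hab).1 ▸ ha)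
      · exact fun hab => hzS ((h b (hS.1 hb) a (hT.1 ha) hab.symm).1 ▸ hb)
      · exact hT.2.1 a ha b hb
    · intro x hx hxS
      simp only [Finset.mem_union, not_or] at hx hxS
      rcases hx with hx | hx
      · obtain ⟨y, hy, hxy⟩ := hS.2.2 x hx hxS.1
        exact ⟨y, by simp [hy], hxy⟩
      · obtain ⟨y, hy, hxy⟩ := hT.2.2 x hx hxS.2
        exact ⟨y, by simp [hy], hxy⟩
  have := this.card_le
  omega

/-- Deleting the edge `ab` does not increase `maxCover`, provided that, apart from `b`, only `a'`
connects `A ∋ a` to its complement, and `a`, `a'` have suitable gains. -/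
theorem maxCover_deleteEdge_le {a b a' : V} {A A' : Finset V}
    (ha : a ∈ A) (hb : b ∉ A) (hab : G.Adj a b) (ha' : a' ∈ A')
    (hA : ∀ x ∈ A, ∀ y ∉ A, G.Adj x y → x = a ∧ (y = b ∨ y = a'))
    (hA' : ∀ x ∈ A', ∀ y ∉ A', G.Adj x y → x = a')
    (hAW : a ∈ W → A ⊆ W) (hA'W : a' ∈ W → A' ⊆ W)
    (hg : G.gain A a = 0 ∨ G.gain A a ≤ 1 ∧ 0 < G.gain A' a') :
    (G.deleteEdges {s(a, b)}).maxCover W ≤ G.maxCover W := by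
  refine maxCover_le fun S hS => ?_
  have hadj : ∀ x y, (G.deleteEdges {s(a, b)}).Adj x y → G.Adj x y := fun x y h => by
    simp only [deleteEdges_adj] at h
    exact h.1
  -- Unless both ends of the deleted edge are chosen, `S` is maximal independent in `G` too.
  by_cases hSab : a ∈ S ∧ b ∈ S
  swap
  · refine IsMaxIndep.card_le ⟨hS.1, fun x hx y hy hxy => hS.2.1 x hx y hy ?_, fun x hx hxS => ?_⟩
    · simp only [deleteEdges_adj, Set.mem_singleton_iff, Sym2.eq_iff]
      refine ⟨hxy, ?_⟩
      rintro (⟨rfl, rfl⟩ | ⟨rfl, rfl⟩)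
      · exact hSab ⟨hx, hy⟩
      · exact hSab ⟨hy, hx⟩
    · obtain ⟨y, hy, hxy⟩ := hS.2.2 x hx hxS
      exact ⟨y, hy, hadj _ _ hxy⟩
  obtain ⟨haS, hbS⟩ := hSab
  have hSi : ∀ x ∈ S, ∀ y ∈ S, x ≠ a → y ≠ a → ¬ G.Adj x y := fun x hx y hy hxa hya hxy => by
    refine hS.2.1 x hx y hy ?_
    simp [deleteEdges_adj, hxy, hxa, hya]
  have hAsub := hAW (hS.1 haS)
  have hSA : G.IsMaxIndep A (S ∩ A) := by
    refine ⟨Finset.inter_subset_right, fun x hx y hy hxy => ?_, fun x hx hxS => ?_⟩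
    · rw [Finset.mem_inter] at hx hy
      refine hS.2.1 x hx.1 y hy.1 ?_
      have h1 : x ≠ b := fun h => hb (h ▸ hx.2)
      have h2 : y ≠ b := fun h => hb (h ▸ hy.2)
      simp [deleteEdges_adj, hxy, h1, h2]
    · have hxS' : x ∉ S := fun h => hxS (by simp [h, hx])
      obtain ⟨y, hy, hxy⟩ := hS.2.2 x (hAsub hx) hxS'
      refine ⟨y, Finset.mem_inter.2 ⟨hy, ?_⟩, hadj _ _ hxy⟩
      by_contra hyA
      exact hxS' ((hA x hx y hyA (hadj _ _ hxy)).1 ▸ haS)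
  -- Exchanging `S ∩ A` for `T` enlarges the cover by at least `1 - G.gain A a` (a loss if
  -- negative); the dropped vertex `a` is dominated by `b`.
  obtain ⟨T, hT, hTc⟩ := G.exists_isMaxIndep_card (A.erase a)
  have haT : a ∉ T := fun h => by simpa using hT.1 h
  have hTA : T ⊆ A := hT.1.trans (Finset.erase_subset _ _)
  have hm := G.maxCover_erase_add_gain A a
  have hTc' := card_sdiff_erase_of_notMem ha haT
  have hc := card_sdiff_exchange hAsub hS.1 hTA
  have hcA := hSA.card_le
  set S₁ := (S \ A) ∪ T with hS₁
  have hS₁W : S₁ ⊆ W :=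
    Finset.union_subset (Finset.sdiff_subset.trans hS.1) (hTA.trans hAsub)
  have hSne : ∀ x ∈ S, x ∉ A → x ≠ a := fun x _ hxA h => hxA (h ▸ ha)
  have hTout : ∀ x ∈ T, ∀ y ∉ A, ¬ G.Adj x y := fun x hx y hy hxy =>
    haT ((hA x (hTA hx) y hy hxy).1 ▸ hx)
  have hi : ∀ x ∈ S₁, ∀ y ∈ S₁, ¬ G.Adj x y := by
    intro x hx y hy
    rw [hS₁, Finset.mem_union, Finset.mem_sdiff] at hx hy
    rcases hx with hx | hx <;> rcases hy with hy | hy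
    · exact hSi x hx.1 y hy.1 (hSne x hx.1 hx.2) (hSne y hy.1 hy.2)
    · exact fun h => hTout y hy x hx.2 h.symm
    · exact hTout x hx y hy.2
    · exact hT.2.1 x hx y hy
  have hdom : ∀ x ∈ W, x ∉ S₁ → x ≠ a' → ∃ y ∈ S₁, G.Adj x y := by
    intro x hx hxS hxa'
    simp only [hS₁, Finset.mem_union, Finset.mem_sdiff, not_or, not_and, not_not] at hxS
    by_cases hxA : x ∈ A
    · by_cases hxa : x = a
      · exact ⟨b, by simp [hS₁, hbS, hb], hxa ▸ hab⟩
      · obtain ⟨y, hy, hxy⟩ := hT.2.2 x (by simp [hxa, hxA]) hxS.2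
        exact ⟨y, by simp [hS₁, hy], hxy⟩
    · have hxS' : x ∉ S := fun h => hxA (hxS.1 h)
      obtain ⟨y, hy, hxy⟩ := hS.2.2 x hx hxS'
      refine ⟨y, ?_, hadj _ _ hxy⟩
      by_cases hyA : y ∈ A
      · rcases (hA y hyA x hxA (hadj _ _ hxy).symm).2 with rfl | rfl
        · exact absurd hbS hxS'
        · exact absurd rfl hxa'
      · simp [hS₁, hy, hyA]
  -- Only `a'` can have lost its domination, namely by `a`.
  by_cases hbad : a' ∈ W ∧ a' ∉ S₁ ∧ ∀ y ∈ S₁, ¬ G.Adj a' y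
  swap
  · have : G.IsMaxIndep W S₁ := by
      refine ⟨hS₁W, hi, fun x hx hxS => ?_⟩
      by_cases hxa' : x = a'
      · subst hxa'
        by_contra! hcon
        exact hbad ⟨hx, hxS, hcon⟩
      · exact hdom x hx hxS hxa'
    have := this.card_le
    omega
  obtain ⟨ha'W, ha'S, hund⟩ := hbad
  -- With gain 0 the exchange won one vertex, which is spent on choosing `a'`. Otherwise `S₁ ∩ A'`
  -- is maximal in `A'.erase a'`, and since `a'` has positive gain, an optimum of `A'` can replace
  -- it without shrinking the cover.
  rcases hg with hg | ⟨hg, hg'⟩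
  · have : G.IsMaxIndep W (insert a' S₁) := by
      refine ⟨Finset.insert_subset ha'W hS₁W, indep_insert hi hund, fun x hx hxS => ?_⟩
      simp only [Finset.mem_insert, not_or] at hxS
      obtain ⟨y, hy, hxy⟩ := hdom x hx hxS.2 hxS.1
      exact ⟨y, by simp [hy], hxy⟩
    have := this.card_le
    rw [Finset.sdiff_insert, Finset.card_erase_of_mem (by simp [ha'W, ha'S])] at this
    omega
  · obtain ⟨T', hT', hTc'⟩ := G.exists_isMaxIndep_card A'
    have hm' := G.maxCover_erase_add_gain A' a'
    have hA'sub := hA'W ha'W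
    have hSA' : G.IsMaxIndep (A'.erase a') (S₁ ∩ A') := by
      refine ⟨fun x hx => ?_, fun x hx y hy => hi x (Finset.mem_inter.1 hx).1 y
        (Finset.mem_inter.1 hy).1, fun x hx hxS => ?_⟩
      · rw [Finset.mem_inter] at hx
        exact Finset.mem_erase.2 ⟨fun h => ha'S (h ▸ hx.1), hx.2⟩
      · rw [Finset.mem_erase] at hx
        have hxS' : x ∉ S₁ := fun h => hxS (by simp [h, hx.2])
        obtain ⟨y, hy, hxy⟩ := hdom x (hA'sub hx.2) hxS' hx.1
        refine ⟨y, Finset.mem_inter.2 ⟨hy, ?_⟩, hxy⟩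
        by_contra hyA
        exact hx.1 (hA' x hx.2 y hyA hxy)
    have hc1 := hSA'.card_le
    have hc2 := card_sdiff_erase_of_notMem (S := S₁ ∩ A') ha' fun h => ha'S (Finset.mem_inter.1 h).1
    have hc3 := card_sdiff_exchange hA'sub hS₁W hT'.1
    have : G.IsMaxIndep W ((S₁ \ A') ∪ T') := by
      refine ⟨Finset.union_subset (Finset.sdiff_subset.trans hS₁W) (hT'.1.trans hA'sub), ?_, ?_⟩
      · intro x hx y hy
        rw [Finset.mem_union, Finset.mem_sdiff] at hx hy
        rcases hx with hx | hx <;> rcases hy with hy | hy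
        · exact hi x hx.1 y hy.1
        · exact fun h => hund x hx.1 (hA' y (hT'.1 hy) x hx.2 h.symm ▸ h.symm)
        · exact fun h => hund y hy.1 (hA' x (hT'.1 hx) y hy.2 h ▸ h)
        · exact hT'.2.1 x hx y hy
      · intro x hx hxS
        simp only [Finset.mem_union, Finset.mem_sdiff, not_or, not_and, not_not] at hxS
        by_cases hxA : x ∈ A'
        · obtain ⟨y, hy, hxy⟩ := hT'.2.2 x hxA hxS.2
          exact ⟨y, by simp [hy], hxy⟩
        · obtain ⟨y, hy, hxy⟩ := hdom x hx (fun h => hxA (hxS.1 h)) fun h => hxA (h ▸ ha')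
          refine ⟨y, ?_, hxy⟩
          have hyA : y ∉ A' := fun h => ha'S (hA' y h x hxA hxy.symm ▸ hy)
          simp [hy, hyA]
    have := this.card_le
    omega

end MaximalIndependent

/-! ### Lower bounds for `maxCover` of glued graphs -/

section Gluing

variable {G : SimpleGraph V} {W : Finset V}

/-- Extend `X` to a maximal independent `Y` in `D`. For `v` in `Y` take an optimal set of `A v`
containing `v`, available because the gain is at least 2. For the other `v` take an optimum of `(A
v).erase v`; such a `v` is dominated by a neighbour in `Y` and counts in the cover. -/
theorem maxCover_biUnion_ge {D X : Finset V} {A : V → Finset V} (hmem : ∀ v ∈ D, v ∈ A v)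
    (hdisj : ∀ u ∈ D, ∀ v ∈ D, u ≠ v → Disjoint (A u) (A v))
    (hcross : ∀ u ∈ D, ∀ v ∈ D, u ≠ v → ∀ x ∈ A u, ∀ y ∈ A v, G.Adj x y → x = u ∧ y = v)
    (hgain : ∀ v ∈ D, 2 ≤ G.gain (A v) v) (hX : X ⊆ D) (hXi : ∀ x ∈ X, ∀ y ∈ X, ¬ G.Adj x y) :
    ∑ v ∈ D, (G.maxCover ((A v).erase v) + 1) + ∑ v ∈ X, (G.gain (A v) v - 1) ≤
      G.maxCover (D.biUnion A) := by
  obtain ⟨Y, hXY, hY⟩ := G.exists_isMaxIndep_superset hX hXi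
  have hS : ∀ v, ∃ S : Finset V, v ∈ D → S ⊆ A v ∧ (∀ x ∈ S, ∀ y ∈ S, ¬ G.Adj x y) ∧
      (∀ x ∈ A v, x ≠ v → x ∉ S → ∃ y ∈ S, G.Adj x y) ∧ (v ∈ S ↔ v ∈ Y) ∧
      (A v \ S).card = G.maxCover ((A v).erase v) + 1 +
        if v ∈ Y then G.gain (A v) v - 1 else 0 := by
    intro v
    by_cases hv : v ∈ D
    swap
    · exact ⟨∅, fun h => absurd h hv⟩
    by_cases hvY : v ∈ Y
    · obtain ⟨S, hS, hvS, hc⟩ := exists_isMaxIndep_mem (hmem v hv) (hgain v hv)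
      refine ⟨S, fun _ => ⟨hS.1, hS.2.1, fun x hx _ hxS => hS.2.2 x hx hxS, by simp [hvS, hvY], ?_⟩⟩
      have h1 := hgain v hv
      have h2 := G.maxCover_erase_add_gain (A v) v
      rw [if_pos hvY]
      omega
    · obtain ⟨S, hS, hc⟩ := G.exists_isMaxIndep_card ((A v).erase v)
      have hvS : v ∉ S := fun h => by simpa using hS.1 h
      refine ⟨S, fun _ => ⟨hS.1.trans (Finset.erase_subset _ _), hS.2.1,
        fun x hx hxv hxS => hS.2.2 x (by simp [hx, hxv]) hxS, by simp [hvS, hvY], ?_⟩⟩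
      rw [if_neg hvY, card_sdiff_erase_of_notMem (hmem v hv) hvS, hc, add_zero]
  choose S hS using hS
  have hU : G.IsMaxIndep (D.biUnion A) (D.biUnion S) := by
    refine ⟨Finset.biUnion_mono fun v hv => (hS v hv).1, ?_, ?_⟩
    · intro x hx y hy hxy
      obtain ⟨u, hu, hxu⟩ := Finset.mem_biUnion.1 hx
      obtain ⟨v, hv, hyv⟩ := Finset.mem_biUnion.1 hy
      by_cases huv : u = v
      · subst huv
        exact (hS u hu).2.1 x hxu y hyv hxy
      · obtain ⟨rfl, rfl⟩ := hcross u hu v hv huv x ((hS u hu).1 hxu) y ((hS v hv).1 hyv) hxy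
        exact hY.2.1 x ((hS x hu).2.2.2.1.1 hxu) y ((hS y hv).2.2.2.1.1 hyv) hxy
    · intro x hx hxS
      obtain ⟨u, hu, hxu⟩ := Finset.mem_biUnion.1 hx
      have hxSu : x ∉ S u := fun h => hxS (Finset.mem_biUnion.2 ⟨u, hu, h⟩)
      by_cases hxv : x = u
      · subst hxv
        obtain ⟨y, hy, hxy⟩ := hY.2.2 x hu fun h => hxSu ((hS x hu).2.2.2.1.2 h)
        exact ⟨y, Finset.mem_biUnion.2 ⟨y, hY.1 hy, (hS y (hY.1 hy)).2.2.2.1.2 hy⟩, hxy⟩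
      · obtain ⟨y, hy, hxy⟩ := (hS u hu).2.2.1 x hxu hxv hxSu
        exact ⟨y, Finset.mem_biUnion.2 ⟨u, hu, hy⟩, hxy⟩
  have hcard : (D.biUnion A \ D.biUnion S).card = ∑ v ∈ D, (A v \ S v).card := by
    rw [← Finset.card_biUnion fun u hu v hv huv =>
      (hdisj u hu v hv huv).mono Finset.sdiff_subset Finset.sdiff_subset]
    congr 1
    ext x
    simp only [Finset.mem_sdiff, Finset.mem_biUnion, not_exists, not_and]
    constructor
    · rintro ⟨⟨u, hu, hxu⟩, h⟩
      exact ⟨u, hu, hxu, h u hu⟩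
    · rintro ⟨u, hu, hxu, h⟩
      refine ⟨⟨u, hu, hxu⟩, fun v hv hxv => ?_⟩
      by_cases huv : u = v
      · exact h (huv ▸ hxv)
      · exact Finset.disjoint_left.1 (hdisj u hu v hv huv) hxu ((hS v hv).1 hxv)
  refine le_trans ?_ (hcard ▸ hU.card_le)
  rw [Finset.sum_congr rfl fun v hv => (hS v hv).2.2.2.2, Finset.sum_add_distrib
    (f := fun v => G.maxCover ((A v).erase v) + 1)]
  refine Nat.add_le_add_left ?_ _
  rw [← Finset.sum_filter, Finset.filter_mem_eq_inter, Finset.inter_eq_right.2 hY.1]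
  exact Finset.sum_le_sum_of_subset hXY

/-- As the gains are 0, removing the neighbours of `z` from the graph without `z` leaves `maxCover`
unchanged. Adding `z` to an optimum of what remains then puts all these neighbours into the cover.
-/
theorem maxCover_erase_add_card_le [Fintype V] {z : V} {T : V → Finset V}
    (hmem : ∀ y, G.Adj z y → y ∈ T y) (hz : ∀ y, G.Adj z y → z ∉ T y)
    (hdisj : ∀ y, G.Adj z y → ∀ y', G.Adj z y' → y ≠ y' → Disjoint (T y) (T y'))
    (hT : ∀ y, G.Adj z y → ∀ a ∈ T y, ∀ b ∉ T y, G.Adj a b → a = y ∧ b = z)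
    (hg : ∀ y, G.Adj z y → G.gain (T y) y = 0) :
    G.maxCover (Finset.univ.erase z) + (Finset.univ.filter (G.Adj z)).card ≤
      G.maxCover Finset.univ := by
  have key : ∀ D : Finset V, (∀ y ∈ D, G.Adj z y) →
      G.maxCover (Finset.univ.erase z \ D) = G.maxCover (Finset.univ.erase z) := by
    intro D
    induction D using Finset.induction_on with
    | empty => simp
    | insert y D hyD ih =>
      intro hD
      have hD' : ∀ y ∈ D, G.Adj z y := fun x hx => hD x (by simp [hx])
      have hzy := hD y (by simp)
      rw [← ih hD']
      have h0 : ∀ x ∈ D, x ∉ T y := fun x hx hxT =>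
        Finset.disjoint_left.1 (hdisj y hzy x (hD' x hx) (fun h => hyD (h ▸ hx))) hxT
          (hmem x (hD' x hx))
      have h1 : Finset.univ.erase z \ D = ((Finset.univ.erase z \ D) \ T y) ∪ T y := by
        rw [Finset.sdiff_union_of_subset]
        intro x hx
        simp only [Finset.mem_sdiff, Finset.mem_erase, Finset.mem_univ, and_true]
        exact ⟨fun h => hz y hzy (h ▸ hx), fun h => h0 x h hx⟩
      have h2 : Finset.univ.erase z \ insert y D =
          ((Finset.univ.erase z \ D) \ T y) ∪ (T y).erase y := by
        ext x
        have := h0 x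
        have h3 : x = z → x ∉ T y := fun h => h ▸ hz y hzy
        have h4 : x = y → x ∈ T y := fun h => h ▸ hmem y hzy
        simp only [Finset.mem_sdiff, Finset.mem_erase, Finset.mem_univ, and_true,
          Finset.mem_union, Finset.mem_insert]
        tauto
      have hcr : ∀ a ∈ (Finset.univ.erase z \ D) \ T y, ∀ b ∈ T y, ¬ G.Adj a b := by
        intro a ha b hb hab
        simp only [Finset.mem_sdiff, Finset.mem_erase] at ha
        exact ha.1.1.1 (hT y hzy b hb a ha.2 hab.symm).2
      have h5 := maxCover_union (G := G)
        (Finset.sdiff_disjoint (s := T y) (t := Finset.univ.erase z \ D)) hcr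
      have h6 := maxCover_union (G := G) (Y := (T y).erase y)
        ((Finset.sdiff_disjoint (s := T y) (t := Finset.univ.erase z \ D)).mono_right
          (Finset.erase_subset _ _)) fun a ha b hb => hcr a ha b (Finset.mem_of_mem_erase hb)
      rw [← h1] at h5
      rw [← h2] at h6
      have := hg y hzy
      have := G.maxCover_erase_add_gain (T y) y
      omega
  have h1 := key (Finset.univ.filter (G.Adj z)) (by simp)
  obtain ⟨S, hS, hc⟩ := G.exists_isMaxIndep_card
    (Finset.univ.erase z \ Finset.univ.filter (G.Adj z))
  have hSz : ∀ x ∈ S, x ≠ z ∧ ¬ G.Adj z x := fun x hx => by simpa using hS.1 hx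
  have : G.IsMaxIndep Finset.univ (insert z S) := by
    refine ⟨by simp, indep_insert hS.2.1 fun y hy => (hSz y hy).2, fun x _ hx => ?_⟩
    simp only [Finset.mem_insert, not_or] at hx
    by_cases hzx : G.Adj z x
    · exact ⟨z, by simp, hzx.symm⟩
    · obtain ⟨y, hy, hxy⟩ := hS.2.2 x (by simp [hx.1, hzx]) hx.2
      exact ⟨y, by simp [hy], hxy⟩
  refine le_trans (le_of_eq ?_) this.card_le
  rw [← h1, ← hc, ← Finset.card_union_of_disjoint]
  · congr 1
    ext x
    have := hSz x
    have h3 : x = z → ¬ G.Adj z x := fun h => h ▸ G.irrefl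
    simp only [Finset.mem_sdiff, Finset.mem_erase, Finset.mem_univ, and_true, true_and,
      Finset.mem_union, Finset.mem_insert, Finset.mem_filter]
    tauto
  · rw [Finset.disjoint_left]
    intro x hx hx'
    simp only [Finset.mem_sdiff] at hx
    exact hx.1.2 hx'

theorem maxCover_congr {H : SimpleGraph V} (h : ∀ x ∈ W, ∀ y ∈ W, G.Adj x y ↔ H.Adj x y) :
    G.maxCover W = H.maxCover W := by
  have : ∀ S, G.IsMaxIndep W S ↔ H.IsMaxIndep W S := by
    refine fun S => and_congr_right fun hS => and_congr ?_ ?_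
    · exact forall₄_congr fun x hx y hy => not_congr (h x (hS hx) y (hS hy))
    · exact forall₃_congr fun x hx _ => exists_congr fun y =>
        and_congr_right fun hy => h x hx y (hS hy)
  unfold maxCover
  congr 1
  ext S
  simp [this]

theorem maxCover_eq_zero (h : ∀ x ∈ W, ∀ y ∈ W, ¬ G.Adj x y) : G.maxCover W = 0 := by
  obtain ⟨S, hS, hc⟩ := G.exists_isMaxIndep_card W
  rw [← hc, Finset.card_eq_zero, Finset.sdiff_eq_empty_iff_subset]
  intro x hx
  by_contra hxS
  obtain ⟨y, hy, hxy⟩ := hS.2.2 x hx hxS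
  exact h x hx y (hS.1 hy) hxy

/-- The graph on the same vertices whose edges are those of `G` inside `W`. -/
def on (G : SimpleGraph V) (W : Finset V) : SimpleGraph V where
  Adj x y := G.Adj x y ∧ x ∈ W ∧ y ∈ W
  symm := ⟨fun _ _ h => ⟨h.1.symm, h.2.2, h.2.1⟩⟩
  loopless := ⟨fun _ h => G.irrefl h.1⟩

theorem on_le (G : SimpleGraph V) (W : Finset V) : G.on W ≤ G := fun _ _ h => h.1

/-- Vertices outside `W` are isolated in `G.on W` and never enter the cover, so the induction can
keep one vertex type. -/
theorem maxCover_on (G : SimpleGraph V) (W Y : Finset V) :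
    (G.on W).maxCover Y = G.maxCover (Y ∩ W) := by
  have h1 : (G.on W).maxCover (Y ∩ W) = G.maxCover (Y ∩ W) := maxCover_congr fun x hx y hy => by
    simp [on, (Finset.mem_inter.1 hx).2, (Finset.mem_inter.1 hy).2]
  have h2 := maxCover_union (G := G.on W) (X := Y \ W) (Y := Y ∩ W)
    (Finset.disjoint_sdiff_inter Y W) fun x hx y _ h => (Finset.mem_sdiff.1 hx).2 h.2.1
  rw [Finset.sdiff_union_inter, h1,
    maxCover_eq_zero (G := G.on W) fun x hx y _ h => (Finset.mem_sdiff.1 hx).2 h.2.1,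
    zero_add] at h2
  exact h2

theorem gain_on_univ [Fintype V] (G : SimpleGraph V) (W : Finset V) (z : V) :
    (G.on W).gain Finset.univ z = G.gain W z := by
  rw [gain, gain, maxCover_on, maxCover_on, Finset.univ_inter, Finset.erase_inter,
    Finset.univ_inter]

end Gluing

/-! ### Counting cycles by their edge sets -/

section Cycles

variable [Fintype V] {G H : SimpleGraph V}

/-- The edge sets of the cycles of `G`. -/
noncomputable def cycleEdgeSets (G : SimpleGraph V) : Finset (Finset (Sym2 V)) :=
  Finset.univ.filter fun E => ∃ (v : V) (c : G.Walk v v), c.IsCycle ∧ c.edges.toFinset = E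

theorem mem_cycleEdgeSets {E : Finset (Sym2 V)} : E ∈ G.cycleEdgeSets ↔
    ∃ (v : V) (c : G.Walk v v), c.IsCycle ∧ c.edges.toFinset = E := by
  simp [cycleEdgeSets]

theorem cycleEdgeSets_mono (h : G ≤ H) : G.cycleEdgeSets ⊆ H.cycleEdgeSets := by
  intro E hE
  obtain ⟨v, c, hc, rfl⟩ := mem_cycleEdgeSets.1 hE
  exact mem_cycleEdgeSets.2 ⟨v, c.mapLe h, hc.mapLe h, by simp⟩

theorem card_cycleEdgeSets_le : G.cycleEdgeSets.card ≤ G.cycleSubgraphs.ncard := by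
  rw [← Set.ncard_coe_finset]
  have hf : G.cycleSubgraphs.Finite := Set.toFinite _
  refine le_trans (Set.ncard_le_ncard ?_ (hf.image fun C => C.edgeSet.toFinset))
    (Set.ncard_image_le hf)
  intro E hE
  obtain ⟨v, c, hc, rfl⟩ := mem_cycleEdgeSets.1 hE
  refine ⟨c.toSubgraph, ⟨v, c, hc, rfl⟩, ?_⟩
  ext e
  simp

theorem exists_adj_of_mem_cycleEdgeSets {E : Finset (Sym2 V)} (hE : E ∈ G.cycleEdgeSets) :
    ∃ x y, s(x, y) ∈ E ∧ G.Adj x y := by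
  obtain ⟨v, c, hc, rfl⟩ := mem_cycleEdgeSets.1 hE
  cases c with
  | nil => exact absurd hc Walk.not_isCycle_nil
  | cons h p => exact ⟨_, _, by simp, h⟩

theorem adj_of_mem_cycleEdgeSets {E : Finset (Sym2 V)} (hE : E ∈ G.cycleEdgeSets) {x y : V}
    (h : s(x, y) ∈ E) : G.Adj x y := by
  obtain ⟨v, c, hc, rfl⟩ := mem_cycleEdgeSets.1 hE
  exact c.adj_of_mem_edges (by simpa using h)

/-- Cycles of different parts have edges in disjoint vertex sets, so they differ; `F` collects
cycles lying in no part. -/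
theorem sum_card_cycleEdgeSets_on {D : Finset V} {A : V → Finset V} {F : Finset (Finset (Sym2 V))}
    (hdisj : ∀ u ∈ D, ∀ v ∈ D, u ≠ v → Disjoint (A u) (A v)) (hF : F ⊆ G.cycleEdgeSets)
    (hFA : ∀ v ∈ D, ∀ E ∈ F, E ∉ (G.on (A v)).cycleEdgeSets) :
    ∑ v ∈ D, (G.on (A v)).cycleEdgeSets.card + F.card ≤ G.cycleEdgeSets.card := by
  rw [← Finset.card_biUnion, ← Finset.card_union_of_disjoint]
  · refine Finset.card_le_card (Finset.union_subset (Finset.biUnion_subset.2 fun v _ => ?_) hF)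
    exact cycleEdgeSets_mono (G.on_le _)
  · rw [Finset.disjoint_left]
    intro E hE hEF
    obtain ⟨v, hv, hEv⟩ := Finset.mem_biUnion.1 hE
    exact hFA v hv E hEF hEv
  · intro u hu v hv huv
    rw [Function.onFun, Finset.disjoint_left]
    intro E hEu hEv
    obtain ⟨x, y, hxy, h⟩ := exists_adj_of_mem_cycleEdgeSets hEu
    exact Finset.disjoint_left.1 (hdisj u hu v hv huv) h.2.1 (adj_of_mem_cycleEdgeSets hEv hxy).2.1

end Cycles

/-! ### The cactus condition for closed walks -/

section CyclesMeetOnce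

variable {G H : SimpleGraph V}

/-- Any two cycles with different edge sets have at most one vertex in common. -/
def CyclesMeetOnce (G : SimpleGraph V) : Prop :=
  ∀ ⦃u v : V⦄ (c : G.Walk u u) (d : G.Walk v v), c.IsCycle → d.IsCycle →
    c.edges.toFinset ≠ d.edges.toFinset → ∀ x ∈ c.support, x ∈ d.support → ∀ y ∈ c.support,
      y ∈ d.support → x = y

theorem IsCactus.cyclesMeetOnce (hG : G.IsCactus) : G.CyclesMeetOnce := by
  intro u v c d hc hd hne x hx hx' y hy hy'
  refine hG _ ⟨u, c, hc, rfl⟩ _ ⟨v, d, hd, rfl⟩ (fun h => hne ?_) ⟨by simpa, by simpa⟩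
    ⟨by simpa, by simpa⟩
  ext e
  simpa using (Set.ext_iff.1 (congrArg Subgraph.edgeSet h)) e

theorem CyclesMeetOnce.mono (hH : H.CyclesMeetOnce) (h : G ≤ H) : G.CyclesMeetOnce := by
  intro u v c d hc hd hne x hx hx' y hy hy'
  refine hH (c.mapLe h) (d.mapLe h) (hc.mapLe h) (hd.mapLe h) ?_ x ?_ ?_ y ?_ ?_ <;> simpa

end CyclesMeetOnce

/-! ### Generators up to radical and how to glue them -/

section Systems

variable {K : Type*} [Field K] {G : SimpleGraph V}

/-- The edge ideal of `G` is, up to radical, generated by at most `a + b` elements, all but at most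
`a` of which are divisible by the variable `z`. -/
def HasSystem (K : Type*) [Field K] (G : SimpleGraph V) (z : V) (a b : ℕ) : Prop :=
  ∃ A B : List (MvPolynomial V K), A.length ≤ a ∧ B.length ≤ b ∧
    (∀ f ∈ A ++ B, f ∈ G.edgeIdeal K) ∧ (∀ f ∈ B, X z ∣ f) ∧
    ∀ P : Ideal (MvPolynomial V K), P.IsPrime → (∀ f ∈ A ++ B, f ∈ P) → G.edgeIdeal K ≤ P

theorem HasSystem.of_le {z : V} {a b p q : ℕ} (h : HasSystem K G z a b) (hap : a ≤ p)
    (hab : a + b ≤ p + q) : HasSystem K G z p q := by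
  obtain ⟨A, B, hA, hB, hI, hz, hP⟩ := h
  refine ⟨A ++ B.take (p - a), B.drop (p - a), ?_, ?_, ?_,
    fun f hf => hz f (List.mem_of_mem_drop hf), ?_⟩
  · simp only [List.length_append, List.length_take]
    omega
  · simp only [List.length_drop]
    omega
  · rwa [List.append_assoc, List.take_append_drop]
  · rwa [List.append_assoc, List.take_append_drop]

theorem HasSystem.change_vertex {z : V} {a b : ℕ} (h : HasSystem K G z a b) (y : V) :
    HasSystem K G y (a + b) 0 := by
  obtain ⟨A, B, hA, hB, hI, hz, hP⟩ := h
  exact ⟨A ++ B, [], by simp only [List.length_append]; omega, by simp, by simpa using hI,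
    by simp, by simpa using hP⟩

theorem hasSystem_bot (z : V) (a b : ℕ) : HasSystem K (⊥ : SimpleGraph V) z a b :=
  ⟨[], [], by simp, by simp, by simp, by simp, fun P _ _ => (edgeIdeal_le_iff K).2 fun x y h =>
    absurd h (by simp)⟩

theorem mem_and_mem_of_add_mem_of_mul_mem {R : Type*} [CommRing R] {P : Ideal R} [P.IsPrime]
    {a b : R} (h : a + b ∈ P) (h' : a * b ∈ P) : a ∈ P ∧ b ∈ P := by
  rcases Ideal.IsPrime.mem_or_mem ‹_› h' with ha | hb
  · exact ⟨ha, (P.add_mem_iff_right ha).1 h⟩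
  · exact ⟨(P.add_mem_iff_left hb).1 h, hb⟩

/-- Every other summand has a factor indexed outside `t`, so it vanishes modulo `P`. -/
theorem prod_mem_of_sum_prod_mem {ι R : Type*} [CommRing R] {P : Ideal R}
    {g : ι → R} {s t : Finset ι} (ht : ∀ i ∈ s, i ∉ t → g i ∈ P) {T : Finset (Finset ι)}
    (hT : ∀ u ∈ T, u ⊆ s ∧ u.card = t.card) (htT : t ∈ T) (h : ∑ u ∈ T, ∏ i ∈ u, g i ∈ P) :
    ∏ i ∈ t, g i ∈ P := by
  rw [← Finset.add_sum_erase _ _ htT] at h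
  refine (P.add_mem_iff_left (Ideal.sum_mem _ fun u hu => ?_)).1 h
  obtain ⟨hut, huT⟩ := Finset.mem_erase.1 hu
  obtain ⟨hus, huc⟩ := hT u huT
  obtain ⟨i, hi, hit⟩ := Finset.not_subset.1 fun h => hut (Finset.eq_of_subset_of_card_le h huc.ge)
  exact Ideal.mem_of_dvd _ (Finset.dvd_prod_of_mem g hi) (ht i (hus hi) hit)

/-- Elements divisible by the variables of `D` may be replaced, up to radical, by sums of their
products, where the number needed is the largest weight of an independent subset of `D`. -/
theorem exists_symmetric_system {I : Ideal (MvPolynomial V K)} {D : Finset V} {E : V → V → Prop}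
    {B : V → List (MvPolynomial V K)} {z : V} {r r' : ℕ} (hBI : ∀ v ∈ D, ∀ f ∈ B v, f ∈ I)
    (hB : ∀ v ∈ D, ∀ f ∈ B v, X v ∣ f)
    (hr : ∀ Y ⊆ D, (∀ x ∈ Y, ∀ y ∈ Y, ¬ E x y) → ∑ v ∈ Y, (B v).length ≤ r)
    (hr' : ∀ Y ⊆ D, z ∉ Y → (∀ x ∈ Y, ∀ y ∈ Y, ¬ E x y) → ∑ v ∈ Y, (B v).length ≤ r') :
    ∃ A C : List (MvPolynomial V K), A.length = r' ∧ C.length = r - r' ∧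
      (∀ f ∈ A ++ C, f ∈ I) ∧ (∀ f ∈ C, X z ∣ f) ∧ ∀ P : Ideal (MvPolynomial V K), P.IsPrime →
        (∀ u ∈ D, ∀ v ∈ D, E u v → X u * X v ∈ P) → (∀ f ∈ A ++ C, f ∈ P) →
        ∀ v ∈ D, ∀ f ∈ B v, f ∈ P := by
  let s : Finset (Σ _ : V, ℕ) := D.sigma fun v => Finset.range (B v).length
  let g : (Σ _ : V, ℕ) → MvPolynomial V K := fun i => (B i.1).getD i.2 0
  have hg : ∀ i ∈ s, i.1 ∈ D ∧ g i ∈ B i.1 := by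
    intro i hi
    simp only [s, Finset.mem_sigma, Finset.mem_range] at hi
    refine ⟨hi.1, ?_⟩
    simp only [g, List.getD_eq_getElem _ _ hi.2]
    exact List.getElem_mem _
  -- Elementary symmetric sums of degrees 1 to `r'`; in the higher degrees only the products with a
  -- factor from `B z` are kept, which makes the sums divisible by `X z`.
  let T : ℕ → Finset (Finset (Σ _ : V, ℕ)) := fun j => s.powersetCard (j + 1)
  let T' : ℕ → Finset (Finset (Σ _ : V, ℕ)) := fun j =>
    (s.powersetCard (r' + j + 1)).filter fun t => ∃ i ∈ t, i.1 = z
  have hprod : ∀ t ⊆ s, 0 < t.card → ∏ i ∈ t, g i ∈ I := by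
    intro t hts ht
    obtain ⟨i, hi⟩ := Finset.card_pos.1 ht
    exact Ideal.mem_of_dvd _ (Finset.dvd_prod_of_mem g hi)
      (hBI _ (hg i (hts hi)).1 _ (hg i (hts hi)).2)
  refine ⟨(List.range r').map fun j => ∑ t ∈ T j, ∏ i ∈ t, g i,
    (List.range (r - r')).map fun j => ∑ t ∈ T' j, ∏ i ∈ t, g i, by simp, by simp, ?_, ?_, ?_⟩
  · intro f hf
    rw [List.mem_append] at hf
    rcases hf with hf | hf <;> obtain ⟨j, -, rfl⟩ := List.mem_map.1 hf
    · refine Ideal.sum_mem _ fun t ht => ?_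
      obtain ⟨h1, h2⟩ := Finset.mem_powersetCard.1 ht
      exact hprod t h1 (by omega)
    · refine Ideal.sum_mem _ fun t ht => ?_
      obtain ⟨h1, h2⟩ := Finset.mem_powersetCard.1 (Finset.mem_filter.1 ht).1
      exact hprod t h1 (by omega)
  · intro f hf
    obtain ⟨j, -, rfl⟩ := List.mem_map.1 hf
    refine Finset.dvd_sum fun t ht => ?_
    obtain ⟨h1, i, hi, rfl⟩ := Finset.mem_filter.1 ht
    have his := (Finset.mem_powersetCard.1 h1).1 hi
    exact (hB _ (hg i his).1 _ (hg i his).2).trans (Finset.dvd_prod_of_mem g hi)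
  · intro P hP hE hAC
    -- The elements outside `P` lie over the independent set `Y`, so there are at most `r` of them.
    -- Were there any, the sum of degree `t.card` would reduce modulo `P` to their product.
    let t := s.filter fun i => g i ∉ P
    let Y := D.filter fun v => (X v : MvPolynomial V K) ∉ P
    have hts : t ⊆ s := Finset.filter_subset _ _
    have hYi : ∀ x ∈ Y, ∀ y ∈ Y, ¬ E x y := by
      intro x hx y hy hxy
      simp only [Y, Finset.mem_filter] at hx hy
      exact (hP.mem_or_mem (hE x hx.1 y hy.1 hxy)).elim hx.2 hy.2
    have htY : ∀ i ∈ t, i.1 ∈ Y := by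
      intro i hi
      obtain ⟨his, hiP⟩ := Finset.mem_filter.1 hi
      obtain ⟨hiD, hiB⟩ := hg i his
      exact Finset.mem_filter.2 ⟨hiD, fun h => hiP (Ideal.mem_of_dvd _ (hB _ hiD _ hiB) h)⟩
    have hcard : ∀ Z : Finset V, (∀ i ∈ t, i.1 ∈ Z) → t.card ≤ ∑ v ∈ Z, (B v).length := by
      intro Z hZ
      refine (Finset.card_le_card (t := Z.sigma fun v => Finset.range (B v).length)
        fun i hi => ?_).trans (by simp [Finset.card_sigma])
      exact Finset.mem_sigma.2 ⟨hZ i hi, (Finset.mem_sigma.1 (hts hi)).2⟩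
    have htP : ∏ i ∈ t, g i ∉ P := by
      rw [hP.prod_mem_iff]
      rintro ⟨i, hi, hiP⟩
      exact (Finset.mem_filter.1 hi).2 hiP
    have hout : ∀ i ∈ s, i ∉ t → g i ∈ P := by
      intro i hi hit
      by_contra hcon
      exact hit (Finset.mem_filter.2 ⟨hi, hcon⟩)
    have ht0 : t = ∅ := by
      by_contra hne
      have hpos : 0 < t.card := Finset.card_pos.2 (Finset.nonempty_iff_ne_empty.2 hne)
      have htr := (hcard Y htY).trans (hr Y (Finset.filter_subset _ _) hYi)
      by_cases hc : t.card ≤ r'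
      · refine htP (prod_mem_of_sum_prod_mem hout (T := T (t.card - 1)) (fun u hu => ?_) ?_
          (hAC _ (List.mem_append_left _ (List.mem_map.2
            ⟨t.card - 1, List.mem_range.2 (by omega), rfl⟩))))
        · obtain ⟨h1, h2⟩ := Finset.mem_powersetCard.1 hu
          exact ⟨h1, by omega⟩
        · exact Finset.mem_powersetCard.2 ⟨hts, by omega⟩
      -- More than `r'` elements cannot avoid `z`, so the product over `t` survives in the truncated
      -- sum.
      · have hz : ∃ i ∈ t, i.1 = z := by
          by_contra! hcon
          refine hc ((hcard (Y.erase z) fun i hi => Finset.mem_erase.2 ⟨hcon i hi, htY i hi⟩).trans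
            (hr' _ ((Finset.erase_subset _ _).trans (Finset.filter_subset _ _)) (by simp) ?_))
          exact fun x hx y hy => hYi x (Finset.mem_of_mem_erase hx) y (Finset.mem_of_mem_erase hy)
        refine htP (prod_mem_of_sum_prod_mem hout (T := T' (t.card - r' - 1)) (fun u hu => ?_) ?_
          (hAC _ (List.mem_append_right _ (List.mem_map.2
            ⟨t.card - r' - 1, List.mem_range.2 (by omega), rfl⟩))))
        · obtain ⟨h1, h2⟩ := Finset.mem_powersetCard.1 (Finset.mem_filter.1 hu).1
          exact ⟨h1, by omega⟩
        · exact Finset.mem_filter.2 ⟨Finset.mem_powersetCard.2 ⟨hts, by omega⟩, hz⟩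
    intro v hv f hf
    obtain ⟨j, hj, rfl⟩ := List.getElem_of_mem hf
    by_contra hcon
    have : (⟨v, j⟩ : Σ _ : V, ℕ) ∈ t := by
      refine Finset.mem_filter.2 ⟨Finset.mem_sigma.2 ⟨hv, Finset.mem_range.2 hj⟩, ?_⟩
      simpa only [g, List.getD_eq_getElem _ _ hj] using hcon
    simp [ht0] at this

theorem HasSystem.of_deleteEdge {z a b : V} {p q : ℕ} (hab : G.Adj a b)
    (h : HasSystem K (G.deleteEdges {s(a, b)}) z p q) : HasSystem K G z (p + 1) q := by
  obtain ⟨A, B, hA, hB, hI, hz, hP⟩ := h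
  refine ⟨(X a * X b) :: A, B, by simpa using hA, hB, ?_, hz, fun P hPp hPm => ?_⟩
  · intro f hf
    rcases List.mem_cons.1 hf with rfl | hf
    · exact X_mul_X_mem_edgeIdeal hab
    · exact edgeIdeal_mono (G.deleteEdges_le _) (hI f hf)
  · have h1 := (edgeIdeal_le_iff K).1 (hP P hPp fun f hf => hPm f (List.mem_cons_of_mem _ hf))
    have h2 : (X a * X b : MvPolynomial V K) ∈ P := hPm _ (by simp)
    refine (edgeIdeal_le_iff K).2 fun x y hxy => ?_
    by_cases he : s(x, y) = s(a, b)
    · rcases Sym2.eq_iff.1 he with ⟨rfl, rfl⟩ | ⟨rfl, rfl⟩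
      · exact h2
      · rwa [mul_comm]
    · exact h1 x y (by simp [deleteEdges_adj, hxy, he])

/-- The second lists of both sides merge into `max b u` symmetric sums over `{z, y}`. Beyond degree
`u` every term needs a factor from the side of `z`, so only `u` sums lack divisibility by `X z`; the
edge `zy` itself is divisible. -/
theorem HasSystem.bridge {z y : V} {W Y : Finset V} {a b t u : ℕ} (hzy : G.Adj z y)
    (h : ∀ x x', G.Adj x x' → (x ∈ W ∧ x' ∈ W) ∨ (x ∈ Y ∧ x' ∈ Y) ∨ s(x, x') = s(z, y))
    (hW : HasSystem K (G.on W) z a b) (hY : HasSystem K (G.on Y) y t u) :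
    HasSystem K G z (a + t + u) (1 + (b - u)) := by
  have hzy' : y ≠ z := hzy.ne'
  obtain ⟨A₁, B₁, hA₁, hB₁, hI₁, hz₁, hP₁⟩ := hW
  obtain ⟨A₂, B₂, hA₂, hB₂, hI₂, hz₂, hP₂⟩ := hY
  have hI₁' := fun f hf => edgeIdeal_mono (G.on_le W) (hI₁ f hf)
  have hI₂' := fun f hf => edgeIdeal_mono (G.on_le Y) (hI₂ f hf)
  have hbound : ∀ Z ⊆ ({z, y} : Finset V), (∀ x ∈ Z, ∀ x' ∈ Z, ¬ G.Adj x x') →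
      ∑ v ∈ Z, (if v = z then B₁ else B₂).length ≤ if z ∈ Z then b else u := by
    intro Z hZ hZi
    by_cases hzZ : z ∈ Z
    · have : Z = {z} := by
        refine Finset.eq_singleton_iff_unique_mem.2 ⟨hzZ, fun x hx => ?_⟩
        have := hZ hx
        simp only [Finset.mem_insert, Finset.mem_singleton] at this
        rcases this with rfl | rfl
        · rfl
        · exact absurd hzy (hZi z hzZ x hx)
      subst this
      simpa using hB₁
    · have : Z ⊆ {y} := by
        intro x hx
        have := hZ hx
        simp only [Finset.mem_insert, Finset.mem_singleton] at this ⊢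
        rcases this with rfl | rfl
        · exact absurd hx hzZ
        · rfl
      rw [if_neg hzZ]
      refine (Finset.sum_le_sum_of_subset this).trans ?_
      simpa [hzy'] using hB₂
  obtain ⟨A, C, hA, hC, hI, hzC, hP⟩ := exists_symmetric_system (I := G.edgeIdeal K)
    (D := {z, y}) (E := G.Adj) (B := fun v => if v = z then B₁ else B₂) (z := z) (r := max b u)
    (r' := u)
    (by
      intro v hv f hf
      split_ifs at hf
      · exact hI₁' f (List.mem_append_right _ hf)
      · exact hI₂' f (List.mem_append_right _ hf))
    (by
      intro v hv f hf
      simp only [Finset.mem_insert, Finset.mem_singleton] at hv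
      rcases hv with rfl | rfl
      · exact hz₁ f (by simpa using hf)
      · exact hz₂ f (by simpa [hzy'] using hf))
    (fun Z hZ hZi => (hbound Z hZ hZi).trans (by split_ifs <;> simp))
    (fun Z hZ hzZ hZi => (hbound Z hZ hZi).trans (by simp [hzZ]))
  refine ⟨A₁ ++ A₂ ++ A, (X z * X y) :: C, ?_, ?_, ?_, ?_, ?_⟩
  · simp only [List.length_append]
    omega
  · simp only [List.length_cons]
    omega
  · intro f hf
    simp only [List.mem_append, List.mem_cons] at hf
    rcases hf with ((hf | hf) | hf) | rfl | hf
    · exact hI₁' f (List.mem_append_left _ hf)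
    · exact hI₂' f (List.mem_append_left _ hf)
    · exact hI f (List.mem_append_left _ hf)
    · exact X_mul_X_mem_edgeIdeal hzy
    · exact hI f (List.mem_append_right _ hf)
  · intro f hf
    rcases List.mem_cons.1 hf with rfl | hf
    · exact Dvd.intro _ rfl
    · exact hzC f hf
  · intro P hPp hPm
    simp only [List.mem_append, List.mem_cons] at hPm
    have hzyP : (X z * X y : MvPolynomial V K) ∈ P := hPm _ (by simp)
    have hB := hP P hPp
      (by
        intro v hv w hw hvw
        simp only [Finset.mem_insert, Finset.mem_singleton] at hv hw
        rcases hv with rfl | rfl <;> rcases hw with rfl | rfl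
        · exact absurd hvw G.irrefl
        · exact hzyP
        · rwa [mul_comm]
        · exact absurd hvw G.irrefl)
      (by
        intro f hf
        rcases List.mem_append.1 hf with hf | hf
        · exact hPm f (by simp [hf])
        · exact hPm f (by simp [hf]))
    have h1 := (edgeIdeal_le_iff K).1 (hP₁ P hPp (by
      intro f hf
      rcases List.mem_append.1 hf with hf | hf
      · exact hPm f (by simp [hf])
      · exact hB z (by simp) f (by simpa using hf)))
    have h2 := (edgeIdeal_le_iff K).1 (hP₂ P hPp (by
      intro f hf
      rcases List.mem_append.1 hf with hf | hf
      · exact hPm f (by simp [hf])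
      · exact hB y (by simp) f (by simpa [hzy'] using hf)))
    refine (edgeIdeal_le_iff K).2 fun x x' hxx' => ?_
    rcases h x x' hxx' with hx | hx | hx
    · exact h1 x x' ⟨hxx', hx⟩
    · exact h2 x x' ⟨hxx', hx⟩
    · rcases Sym2.eq_iff.1 hx with ⟨rfl, rfl⟩ | ⟨rfl, rfl⟩
      · exact hzyP
      · rwa [mul_comm]

/-- The sums `g + u₀u₁`, `f u₀ + u₁u₂`, `f u₁ + u₂u₃`, …, followed by the last pending `f uᵢ`, along
a walk with vertices `u₀, u₁, …`. -/
noncomputable def walkSums (f : V → MvPolynomial V K) :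
    ∀ {u w : V}, MvPolynomial V K → G.Walk u w → List (MvPolynomial V K)
  | _, _, g, .nil => [g]
  | u, _, g, .cons (v := v) _ p => (g + X u * X v) :: walkSums f (f u) p

theorem length_walkSums (f : V → MvPolynomial V K) {u w : V} (g : MvPolynomial V K)
    (p : G.Walk u w) : (walkSums f g p).length = p.length + 1 := by
  induction p generalizing g with
  | nil => rfl
  | cons h p ih => simp [walkSums, ih]

theorem walkSums_mem {f : V → MvPolynomial V K} {I : Ideal (MvPolynomial V K)}
    (hI : G.edgeIdeal K ≤ I) (hf : ∀ v, f v ∈ I) {u w : V} {g : MvPolynomial V K} (hg : g ∈ I)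
    (p : G.Walk u w) : ∀ q ∈ walkSums f g p, q ∈ I := by
  induction p generalizing g with
  | nil => simpa [walkSums] using hg
  | cons h p ih =>
    intro q hq
    rcases List.mem_cons.1 hq with rfl | hq
    · exact I.add_mem hg (hI (X_mul_X_mem_edgeIdeal h))
    · exact ih (hf _) q hq

/-- The pending term is a multiple of the previous vertex, so its product with the next edge is a
multiple of the previous edge, already in `P`; hence both summands lie in `P`. The end `w` is exempt
because arriving there starts no new pending term. -/
theorem mem_of_walkSums_mem {f : V → MvPolynomial V K} (hf : ∀ v, X v ∣ f v)
    {P : Ideal (MvPolynomial V K)} [P.IsPrime] {u w : V} (p : G.Walk u w) :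
    ∀ {z : V} {g : MvPolynomial V K}, X z ∣ g → X z * X u ∈ P → (∀ q ∈ walkSums f g p, q ∈ P) →
      g ∈ P ∧ (∀ x y, s(x, y) ∈ p.edges → X x * X y ∈ P) ∧ ∀ v ∈ p.support, v = w ∨ f v ∈ P := by
  induction p with
  | nil =>
    intro z g hg hzu hP
    exact ⟨hP g (by simp [walkSums]), by simp, by simp⟩
  | @cons u v w h p ih =>
    intro z g hg hzu hP
    have hmul : g * (X u * X v) ∈ P := by
      obtain ⟨k, rfl⟩ := hg
      have : X z * k * (X u * X v) = X z * X u * (k * X v) := by ring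
      exact this ▸ P.mul_mem_right _ hzu
    obtain ⟨h1, h2⟩ := mem_and_mem_of_add_mem_of_mul_mem (hP (g + X u * X v) (by simp [walkSums])) hmul
    obtain ⟨h3, h4, h5⟩ := ih (hf u) h2 fun q hq => hP q (List.mem_cons_of_mem _ hq)
    refine ⟨h1, fun x y hxy => ?_, fun x hx => ?_⟩
    · rw [Walk.edges_cons, List.mem_cons] at hxy
      rcases hxy with hxy | hxy
      · rcases Sym2.eq_iff.1 hxy with ⟨rfl, rfl⟩ | ⟨rfl, rfl⟩
        · exact h2
        · rwa [mul_comm]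
      · exact h4 x y hxy
    · rw [Walk.support_cons, List.mem_cons] at hx
      rcases hx with rfl | hx
      · exact .inr h3
      · exact h5 x hx

/-- The first edge, divisible by `X z`, starts the chain of walk sums, which absorbs the other edges
and one element of each part. At most `β v - 1` elements of a second list remain, and these are
merged by symmetric sums. -/
theorem HasSystem.cycle {z v : V} {h : G.Adj z v} {p : G.Walk v z} {D : Finset V}
    {A : V → Finset V} {α β : V → ℕ} {r r' : ℕ}
    (hD : ∀ x, x ∈ D ↔ x ∈ p.support)
    (hedge : ∀ x y, G.Adj x y → (∃ v ∈ D, x ∈ A v ∧ y ∈ A v) ∨ s(x, y) ∈ (Walk.cons h p).edges)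
    (hA : ∀ v ∈ D, HasSystem K (G.on (A v)) v (α v) (β v))
    (hr : ∀ Y ⊆ D, (∀ x ∈ Y, ∀ y ∈ Y, s(x, y) ∉ (Walk.cons h p).edges) →
      ∑ v ∈ Y, (β v - 1) ≤ r)
    (hr' : ∀ Y ⊆ D, z ∉ Y → (∀ x ∈ Y, ∀ y ∈ Y, s(x, y) ∉ (Walk.cons h p).edges) →
      ∑ v ∈ Y, (β v - 1) ≤ r') :
    HasSystem K G z (∑ v ∈ D, α v + (p.length + 1) + r') (1 + (r - r')) := by
  have hA' : ∀ v, ∃ A' B' : List (MvPolynomial V K), v ∈ D → A'.length ≤ α v ∧ B'.length ≤ β v ∧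
      (∀ f ∈ A' ++ B', f ∈ (G.on (A v)).edgeIdeal K) ∧ (∀ f ∈ B', X v ∣ f) ∧
      ∀ P : Ideal (MvPolynomial V K), P.IsPrime → (∀ f ∈ A' ++ B', f ∈ P) →
        (G.on (A v)).edgeIdeal K ≤ P := by
    intro v
    by_cases hv : v ∈ D
    · obtain ⟨A', B', h'⟩ := hA v hv
      exact ⟨A', B', fun _ => h'⟩
    · exact ⟨[], [], fun h => absurd h hv⟩
  choose A' B' hAB using hA'
  have hIv : ∀ v ∈ D, ∀ f ∈ A' v ++ B' v, f ∈ G.edgeIdeal K := fun v hv f hf =>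
    edgeIdeal_mono (G.on_le _) ((hAB v hv).2.2.1 f hf)
  -- The default 0 is harmless: it lies in the ideal and is divisible by everything.
  let f : V → MvPolynomial V K := fun v => if v ∈ D then (B' v).headD 0 else 0
  have hf : ∀ v, f v ∈ G.edgeIdeal K ∧ X v ∣ f v := by
    intro v
    by_cases hv : v ∈ D
    · simp only [f, if_pos hv]
      cases hB : B' v with
      | nil => simp
      | cons b l =>
        exact ⟨hIv v hv b (by simp [hB]), (hAB v hv).2.2.2.1 b (by simp [hB])⟩
    · simp [f, hv]
  have hlen : ∀ Y ⊆ D, ∑ v ∈ Y, (B' v).tail.length ≤ ∑ v ∈ Y, (β v - 1) := fun Y hY =>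
    Finset.sum_le_sum fun v hv => by
      have := (hAB v (hY hv)).2.1
      rw [List.length_tail]
      omega
  obtain ⟨A₁, C, hA₁, hC, hI, hzC, hP⟩ := exists_symmetric_system (I := G.edgeIdeal K) (D := D)
    (E := fun x y => s(x, y) ∈ (Walk.cons h p).edges) (B := fun v => (B' v).tail) (z := z) (r := r)
    (r' := r') (fun v hv f hf => hIv v hv f (List.mem_append_right _ (List.mem_of_mem_tail hf)))
    (fun v hv f hf => (hAB v hv).2.2.2.1 f (List.mem_of_mem_tail hf))
    (fun Y hY hYi => (hlen Y hY).trans (hr Y hY hYi))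
    (fun Y hY hzY hYi => (hlen Y hY).trans (hr' Y hY hzY hYi))
  refine ⟨D.toList.flatMap A' ++ walkSums f (f z) p ++ A₁, (X z * X v) :: C, ?_, ?_, ?_, ?_, ?_⟩
  · rw [List.length_append, List.length_append, length_walkSums, hA₁, List.length_flatMap,
      Finset.sum_map_toList]
    have : ∑ v ∈ D, (A' v).length ≤ ∑ v ∈ D, α v := Finset.sum_le_sum fun v hv => (hAB v hv).1
    omega
  · simp only [List.length_cons]
    omega
  · intro q hq
    simp only [List.mem_append, List.mem_cons, List.mem_flatMap, Finset.mem_toList] at hq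
    rcases hq with ((⟨v, hv, hq⟩ | hq) | hq) | rfl | hq
    · exact hIv v hv q (List.mem_append_left _ hq)
    · exact walkSums_mem le_rfl (fun v => (hf v).1) (hf z).1 p q hq
    · exact hI q (List.mem_append_left _ hq)
    · exact X_mul_X_mem_edgeIdeal h
    · exact hI q (List.mem_append_right _ hq)
  · intro q hq
    rcases List.mem_cons.1 hq with rfl | hq
    · exact Dvd.intro _ rfl
    · exact hzC q hq
  · intro P hPp hPm
    simp only [List.mem_append, List.mem_cons, List.mem_flatMap, Finset.mem_toList] at hPm
    have hzv : (X z * X v : MvPolynomial V K) ∈ P := hPm _ (by simp)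
    -- Starting with `f z` pending compensates for the exempt end vertex `z`.
    obtain ⟨h1, h2, h3⟩ := mem_of_walkSums_mem (fun v => (hf v).2) p (hf z).2 hzv
      fun q hq => hPm q (by simp [hq])
    have hcyc : ∀ x y, s(x, y) ∈ (Walk.cons h p).edges → (X x * X y : MvPolynomial V K) ∈ P := by
      intro x y hxy
      rw [Walk.edges_cons, List.mem_cons] at hxy
      rcases hxy with hxy | hxy
      · rcases Sym2.eq_iff.1 hxy with ⟨rfl, rfl⟩ | ⟨rfl, rfl⟩
        · exact hzv
        · rwa [mul_comm]
      · exact h2 x y hxy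
    have htail := hP P hPp (fun u _ v _ huv => hcyc u v huv) (by
      intro q hq
      rcases List.mem_append.1 hq with hq | hq
      · exact hPm q (by simp [hq])
      · exact hPm q (by simp [hq]))
    have hfP : ∀ v ∈ D, f v ∈ P := by
      intro v hv
      rcases h3 v ((hD v).1 hv) with rfl | h
      · exact h1
      · exact h
    have hpart : ∀ v ∈ D, (G.on (A v)).edgeIdeal K ≤ P := by
      intro v hv
      refine (hAB v hv).2.2.2.2 P hPp fun q hq => ?_
      rcases List.mem_append.1 hq with hq | hq
      · exact hPm q (.inl (.inl (.inl ⟨v, hv, hq⟩)))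
      · have h4 := hfP v hv
        have h5 := htail v hv
        simp only [f, if_pos hv] at h4
        cases hB : B' v with
        | nil => simp [hB] at hq
        | cons b l =>
          rw [hB] at hq h4 h5
          rcases List.mem_cons.1 hq with rfl | hq
          · exact h4
          · exact h5 q hq
    refine (edgeIdeal_le_iff K).2 fun x y hxy => ?_
    rcases hedge x y hxy with ⟨v, hv, hx, hy⟩ | hc
    · exact (edgeIdeal_le_iff K).1 (hpart v hv) x y ⟨hxy, hx, hy⟩
    · exact hcyc x y hc

end Systems

/-! ### Cutting a cactus at a cycle or at a bridge -/

section Structure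

variable {G : SimpleGraph V}

/-- A path joining two vertices of `c` without its edges, and meeting `c` only at its ends, would
close up with an arc of `c` to another cycle sharing both vertices with `c`. -/
theorem CyclesMeetOnce.not_reachable (hG : G.CyclesMeetOnce) {z : V} {c : G.Walk z z}
    (hc : c.IsCycle) {u v : V} (hu : u ∈ c.support) (hv : v ∈ c.support) (huv : u ≠ v) :
    ¬ (G.deleteEdges {e | e ∈ c.edges}).Reachable u v := by
  rintro ⟨p⟩
  induction hn : p.length using Nat.strong_induction_on generalizing u v with
  | _ n ih =>
    subst hn
    -- A further vertex of `c` on the path yields a shorter connection.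
    by_cases hw : ∃ w ∈ p.bypass.support, w ∈ c.support ∧ w ≠ u ∧ w ≠ v
    · obtain ⟨w, hwp, hwc, hwu, hwv⟩ := hw
      exact ih _ ((Walk.length_takeUntil_lt_length hwp hwv).trans_le p.length_bypass_le_length) hu
        hwc hwu.symm (p.bypass.takeUntil w hwp) rfl
    · push Not at hw
      have hp := p.bypass_isPath
      generalize p.bypass = p' at hp hw
      have hle := G.deleteEdges_le {e | e ∈ c.edges}
      have hpe : ∀ e ∈ p'.edges, e ∉ c.edges := by
        intro e he hec
        have := p'.edges_subset_edgeSet he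
        rw [edgeSet_deleteEdges] at this
        exact this.2 hec
      have huc : u ∈ (c.rotate v hv).support := by simpa using hu
      let q := (c.rotate v hv).takeUntil u huc
      have hq : q.IsPath := (hc.rotate hv).isPath_takeUntil huc
      have hqs : ∀ x ∈ q.support, x ∈ c.support := fun x hx => by
        simpa using (c.rotate v hv).support_takeUntil_subset_support huc hx
      have hqe : ∀ e ∈ q.edges, e ∈ c.edges := fun e he => by
        have := (c.rotate v hv).edges_takeUntil_subset_edges huc he
        rwa [(c.rotate_edges v hv).mem_iff] at this
      have hp0 : p'.length ≠ 0 := fun h => huv (Walk.eq_of_length_eq_zero h)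
      have hq0 : q.length ≠ 0 := fun h => huv (Walk.eq_of_length_eq_zero h).symm
      have hd : ((p'.mapLe hle).append q).IsCycle := by
        refine (hp.mapLe hle).isCycle_append hq ?_ ?_
        · intro x hx hxq
          rw [Walk.support_mapLe_eq_support] at hx
          have h1 := hw x (List.mem_of_mem_tail hx) (hqs x (List.mem_of_mem_tail hxq))
          by_cases hxu : x = u
          · subst hxu
            have := hp.support_nodup
            rw [← p'.cons_tail_support, List.nodup_cons] at this
            exact this.1 hx
          · have hxv := h1 hxu
            subst hxv
            have := hq.support_nodup
            rw [← q.cons_tail_support, List.nodup_cons] at this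
            exact this.1 hxq
        -- If both pieces were single edges, the edge `uv` would be both in `c` and deleted.
        · by_contra! hcon
          simp only [Walk.length_map] at hcon
          have h1 : p'.length = 1 := by
            have := hcon.1
            omega
          have h2 : q.length = 1 := by omega
          cases p' with
          | nil => exact huv rfl
          | cons h t =>
            cases t with
            | cons h' t => simp at h1
            | nil =>
              cases hq' : q with
              | nil => exact huv rfl
              | cons h' t =>
                cases t with
                | cons h' t => simp [hq'] at h2
                | nil =>
                  refine hpe s(u, v) (by simp) (hqe _ ?_)
                  rw [hq']
                  simp [Sym2.eq_swap]
      refine huv (hG c _ hc hd (fun h => ?_) u hu (by simp) v hv (by simp))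
      cases p' with
      | nil => exact huv rfl
      | cons h' t =>
        refine hpe s(u, _) (List.mem_cons_self ..) ?_
        rw [← List.mem_toFinset, h]
        simp

variable [Fintype V]

theorem CyclesMeetOnce.exists_parts (hG : G.CyclesMeetOnce) {z : V} {c : G.Walk z z}
    (hc : c.IsCycle) : ∃ A : V → Finset V, (∀ v ∈ c.support, v ∈ A v) ∧
      (∀ u ∈ c.support, ∀ v ∈ c.support, u ≠ v → Disjoint (A u) (A v)) ∧
      (∀ x, ∃ v ∈ c.support, x ∈ A v) ∧
      ∀ u ∈ c.support, ∀ v ∈ c.support, u ≠ v → ∀ x ∈ A u, ∀ y ∈ A v, G.Adj x y →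
        x = u ∧ y = v ∧ s(x, y) ∈ c.edges := by
  let B : V → Finset V := fun v => Finset.univ.filter fun x =>
    (G.deleteEdges {e | e ∈ c.edges}).Reachable v x
  have hB : ∀ v x, x ∈ B v ↔ (G.deleteEdges {e | e ∈ c.edges}).Reachable v x := by simp [B]
  have hBd : ∀ u ∈ c.support, ∀ v ∈ c.support, u ≠ v → Disjoint (B u) (B v) := by
    intro u hu v hv huv
    rw [Finset.disjoint_left]
    intro x hxu hxv
    rw [hB] at hxu hxv
    exact hG.not_reachable hc hu hv huv (hxu.trans hxv.symm)
  have hBe : ∀ v, ∀ x ∈ B v, ∀ y ∉ B v, G.Adj x y → s(x, y) ∈ c.edges := by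
    intro v x hx y hy hxy
    rw [hB] at hx hy
    by_contra he
    exact hy (hx.trans (Adj.reachable (by simp [deleteEdges_adj, hxy, he])))
  -- The part of `z` also receives the vertices connected to no cycle vertex, so that the parts
  -- cover `V`.
  let A : V → Finset V := fun v =>
    if v = z then Finset.univ.filter fun x => ∀ u ∈ c.support, u ≠ z → x ∉ B u else B v
  have hAz : ∀ x, x ∈ A z ↔ ∀ u ∈ c.support, u ≠ z → x ∉ B u := by simp [A]
  have hAB : ∀ v, v ≠ z → A v = B v := fun v hv => by simp [A, hv]
  have hmem : ∀ v ∈ c.support, v ∈ A v := by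
    intro v hv
    by_cases hvz : v = z
    · subst hvz
      rw [hAz]
      exact fun u hu huz h => Finset.disjoint_left.1 (hBd u hu v hv huz) h
        ((hB _ _).2 (Reachable.refl _))
    · rw [hAB v hvz, hB]
  have hdisj : ∀ u ∈ c.support, ∀ v ∈ c.support, u ≠ v → Disjoint (A u) (A v) := by
    intro u hu v hv huv
    by_cases huz : u = z
    · subst huz
      rw [Finset.disjoint_left]
      intro x hx
      rw [hAB v huv.symm]
      exact (hAz x).1 hx v hv huv.symm
    · rw [hAB u huz]
      by_cases hvz : v = z
      · subst hvz
        rw [Finset.disjoint_right]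
        exact fun x hx => (hAz x).1 hx u hu huz
      · rw [hAB v hvz]
        exact hBd u hu v hv huv
  have huniq : ∀ v ∈ c.support, ∀ x ∈ A v, x ∈ c.support → x = v := by
    intro v hv x hx hxc
    by_contra hxv
    exact Finset.disjoint_left.1 (hdisj x hxc v hv hxv) (hmem x hxc) hx
  refine ⟨A, hmem, hdisj, fun x => ?_, ?_⟩
  · by_cases h : ∃ u ∈ c.support, u ≠ z ∧ x ∈ B u
    · obtain ⟨u, hu, huz, hx⟩ := h
      exact ⟨u, hu, by rwa [hAB u huz]⟩
    · push Not at h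
      exact ⟨z, c.start_mem_support, (hAz x).2 h⟩
  · intro u hu v hv huv x hx y hy hxy
    have he : s(x, y) ∈ c.edges := by
      by_cases huz : u = z
      · have hvz : v ≠ z := fun h => huv (huz.trans h.symm)
        rw [Sym2.eq_swap]
        refine hBe v y (hAB v hvz ▸ hy) x (fun h => ?_) hxy.symm
        exact Finset.disjoint_left.1 (hdisj u hu v hv huv) hx ((hAB v hvz).symm ▸ h)
      · refine hBe u x (hAB u huz ▸ hx) y (fun h => ?_) hxy
        exact Finset.disjoint_left.1 (hdisj u hu v hv huv) ((hAB u huz).symm ▸ h) hy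
    exact ⟨huniq u hu x hx (c.fst_mem_support_of_mem_edges he),
      huniq v hv y hy (c.snd_mem_support_of_mem_edges he), he⟩

/-- `T` is attached to the rest of `G` only through the edge `zy`, where `y ∈ T`. -/
structure IsBranch (G : SimpleGraph V) (z y : V) (T : Finset V) : Prop where
  adj : G.Adj z y
  mem : y ∈ T
  notMem : z ∉ T
  cross : ∀ a ∈ T, ∀ b ∉ T, G.Adj a b → a = y ∧ b = z

/-- The vertices connected to `y` without using the edge `zy`. -/
noncomputable def branch (G : SimpleGraph V) (z y : V) : Finset V :=
  Finset.univ.filter fun x => (G.deleteEdges {s(z, y)}).Reachable y x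

theorem isBranch_branch {z y : V} (hz : ∀ (u : V) (c : G.Walk u u), c.IsCycle → z ∉ c.support)
    (hzy : G.Adj z y) : G.IsBranch z y (G.branch z y) := by
  have hb : G.IsBridge s(z, y) := (isBridge_iff_forall_cycle_notMem hzy).2 fun u c hc he =>
    hz u c hc (c.fst_mem_support_of_mem_edges he)
  rw [isBridge_iff] at hb
  refine ⟨hzy, by simp [branch], fun h => hb ?_, fun a ha b hb' hab => ?_⟩
  · exact (Finset.mem_filter.1 h).2.symm
  · simp only [branch, Finset.mem_filter, Finset.mem_univ, true_and] at ha hb'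
    have he : s(a, b) = s(z, y) := by
      by_contra he
      exact hb' (ha.trans (Adj.reachable (by simp [deleteEdges_adj, hab, he])))
    rcases Sym2.eq_iff.1 he with ⟨rfl, rfl⟩ | ⟨rfl, rfl⟩
    · exact absurd ha.symm hb
    · exact ⟨rfl, rfl⟩

/-- A walk from `y` avoiding the edge `zy` could enter `T` only from `z`, which is not in the branch
of `y`. -/
theorem IsBranch.disjoint_branch {z x y : V} {T : Finset V} (hT : G.IsBranch z x T)
    (hy : G.IsBranch z y (G.branch z y)) (hxy : x ≠ y) : Disjoint T (G.branch z y) := by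
  have hyT : y ∉ T := fun h => hxy (hT.cross y h z hT.notMem hy.adj.symm).1.symm
  have key : ∀ w w', (G.deleteEdges {s(z, y)}).Walk w w' → w ∈ G.branch z y → w ∉ T →
      w' ∉ T := by
    intro w w' p
    induction p with
    | nil => exact fun _ h => h
    | @cons u v w h p ih =>
      intro hu huT
      have hv : v ∈ G.branch z y := by
        simp only [branch, Finset.mem_filter, Finset.mem_univ, true_and] at hu ⊢
        exact hu.trans h.reachable
      refine ih hv fun hvT => ?_
      have := (hT.cross v hvT u huT (G.deleteEdges_le _ h).symm).2
      exact hy.notMem (this ▸ hu)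
  rw [Finset.disjoint_right]
  intro w hw
  obtain ⟨p⟩ := (Finset.mem_filter.1 hw).2
  exact key y w p hy.mem hyT

end Structure

/-! ### Gains on the two sides of a bridge -/

section Branches

variable {G : SimpleGraph V}

theorem on_lt {W : Finset V} {x y : V} (h : G.Adj x y) (hxy : ¬ (x ∈ W ∧ y ∈ W)) : G.on W < G :=
  lt_of_le_of_ne (G.on_le W) fun he => hxy (he.symm ▸ h : (G.on W).Adj x y).2

theorem deleteEdge_lt {x y : V} (h : G.Adj x y) : G.deleteEdges {s(x, y)} < G :=
  lt_of_le_of_ne (G.deleteEdges_le _) fun he => by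
    have : (G.deleteEdges {s(x, y)}).Adj x y := he.symm ▸ h
    simp [deleteEdges_adj] at this

namespace IsBranch

variable {z y : V} {T W : Finset V}

theorem maxCover_erase (hT : G.IsBranch z y T) (hTW : T ⊆ W) :
    G.maxCover (W.erase z) = G.maxCover ((W \ T).erase z) + G.maxCover T := by
  rw [← maxCover_union (Finset.sdiff_disjoint.mono_left (Finset.erase_subset _ _))]
  · congr 1
    ext x
    have h1 := @hTW x
    have h2 : x = z → x ∉ T := fun h => h ▸ hT.notMem
    simp only [Finset.mem_union, Finset.mem_erase, Finset.mem_sdiff]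
    tauto
  · intro a ha b hb hab
    simp only [Finset.mem_erase, Finset.mem_sdiff] at ha
    exact ha.1 (hT.cross b hb a ha.2.2 hab.symm).2

theorem cross_left (hT : G.IsBranch z y T) :
    ∀ a ∈ W \ T, ∀ b ∈ T, G.Adj a b → a = z ∧ b = y := fun a ha b hb hab =>
  (hT.cross b hb a (Finset.mem_sdiff.1 ha).2 hab.symm).symm

theorem cross_right (hT : G.IsBranch z y T) :
    ∀ a ∈ T, ∀ b ∈ W \ T, G.Adj a b → a = y ∧ b = z := fun a ha b hb hab =>
  hT.cross a ha b (Finset.mem_sdiff.1 hb).2 hab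

/-- Gain 0 puts `y` into an optimal set of `T`; then `z` is dominated by `y` and joins the cover. -/
theorem gain_pos (hT : G.IsBranch z y T) (hTW : T ⊆ W) (hz : z ∈ W) (hg : G.gain T y = 0) :
    0 < G.gain W z := by
  obtain ⟨S, hS, hyS, hc⟩ := exists_isMaxIndep_mem_of_gain_eq_zero hT.mem hg
  have h1 := hS.bridge_le (Finset.disjoint_sdiff (s := T) (t := W)) (by simp [hz, hT.notMem])
    hT.adj.symm hT.cross_right hyS
  rw [Finset.union_sdiff_of_subset hTW] at h1
  have h2 := hT.maxCover_erase hTW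
  have h3 := G.maxCover_erase_add_gain W z
  omega

/-- A larger gain of at least 2 gives an optimum containing that end of the bridge, which pushes the
other end into the cover. With smaller gains, both are 0 or both are 1, and one extra vertex comes
from `gain_pos` or `gain_pos_of_bridge`. The hypothesis excludes only the gains 0 and 1 together. -/
theorem le_maxCover (hT : G.IsBranch z y T) (hTW : T ⊆ W) (hz : z ∈ W)
    (h : 2 ≤ G.gain (W \ T) z ∨ 2 ≤ G.gain T y ∨ (G.gain (W \ T) z = 0 ↔ G.gain T y = 0)) :
    G.maxCover ((W \ T).erase z) + G.maxCover (T.erase y) + 1 +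
      max (G.gain (W \ T) z) (G.gain T y) ≤ G.maxCover W := by
  have hd : Disjoint (W \ T) T := Finset.sdiff_disjoint
  have hz' : z ∈ W \ T := by simp [hz, hT.notMem]
  have hu : W \ T ∪ T = W := Finset.sdiff_union_of_subset hTW
  have hm := G.maxCover_erase_add_gain (W \ T) z
  have hm' := G.maxCover_erase_add_gain T y
  by_cases h2 : 2 ≤ max (G.gain (W \ T) z) (G.gain T y)
  · rcases le_total (G.gain T y) (G.gain (W \ T) z) with hle | hle
    · rw [max_eq_left hle] at h2 ⊢
      obtain ⟨S, hS, hzS, hc⟩ := exists_isMaxIndep_mem hz' h2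
      have := hS.bridge_le hd hT.mem hT.adj hT.cross_left hzS
      rw [hu] at this
      omega
    · rw [max_eq_right hle] at h2 ⊢
      obtain ⟨S, hS, hyS, hc⟩ := exists_isMaxIndep_mem hT.mem h2
      have := hS.bridge_le hd.symm hz' hT.adj.symm hT.cross_right hyS
      rw [Finset.union_comm, hu] at this
      omega
  · by_cases h0 : G.gain T y = 0
    · have h1 := hT.gain_pos hTW hz h0
      have h3 := G.maxCover_erase_add_gain W z
      have h4 := hT.maxCover_erase hTW
      omega
    · have := gain_pos_of_bridge hd hT.mem hT.adj hT.cross_left (Nat.pos_of_ne_zero h0)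
      rw [hu] at this
      omega

end IsBranch

end Branches

/-! ### The induction on the edges -/

section Induction

variable [Fintype V] {K : Type*} [Field K] {G : SimpleGraph V}

/-- The bound that is proved by induction: the total number of generators is at most
`maxCover` plus the number of cycles, and those not divisible by `z` are bounded similarly. -/
def HasBoundedSystem (K : Type*) [Field K] (G : SimpleGraph V) (z : V) : Prop :=
  HasSystem K G z (G.maxCover (Finset.univ.erase z) + G.cycleEdgeSets.card)
    (G.gain Finset.univ z)

theorem HasBoundedSystem.on {W : Finset V} {z : V} (h : HasBoundedSystem K (G.on W) z) :
    HasSystem K (G.on W) z (G.maxCover (W.erase z) + (G.on W).cycleEdgeSets.card)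
      (G.gain W z) := by
  rw [HasBoundedSystem, gain_on_univ, maxCover_on, Finset.erase_inter, Finset.univ_inter] at h
  exact h

/-- When `z` has gain 0, no divisibility by `X z` is required, and a system for any vertex serves.
-/
theorem HasBoundedSystem.change_vertex {y z : V} (h : HasBoundedSystem K G y)
    (hz : G.maxCover Finset.univ ≤ G.maxCover (Finset.univ.erase z)) :
    HasBoundedSystem K G z := by
  have := G.maxCover_erase_add_gain Finset.univ y
  exact (HasSystem.change_vertex h z).of_le (by omega) (by omega)

theorem IsBranch.hasBoundedSystem {z y : V} {T : Finset V} (hT : G.IsBranch z y T)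
    (ih : ∀ H < G, ∀ x, HasBoundedSystem K H x)
    (h : G.maxCover ((Finset.univ \ T).erase z) + G.maxCover (T.erase y) + 1 +
      max (G.gain (Finset.univ \ T) z) (G.gain T y) ≤ G.maxCover Finset.univ) :
    HasBoundedSystem K G z := by
  have h1 := (ih _ (on_lt (W := Finset.univ \ T) hT.adj (by simp [hT.mem])) z).on
  have h2 := (ih _ (on_lt (W := T) hT.adj (by simp [hT.notMem])) y).on
  have h3 := h1.bridge hT.adj (fun x x' hxx' => by
    by_cases hx : x ∈ T <;> by_cases hx' : x' ∈ T
    · exact .inr (.inl ⟨hx, hx'⟩)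
    · obtain ⟨rfl, rfl⟩ := hT.cross x hx x' hx' hxx'
      exact .inr (.inr Sym2.eq_swap)
    · obtain ⟨rfl, rfl⟩ := hT.cross x' hx' x hx hxx'.symm
      exact .inr (.inr rfl)
    · exact .inl (by simp [hx, hx'])) h2
  have hn := sum_card_cycleEdgeSets_on (G := G) (D := {z, y})
    (A := fun v => if v = z then Finset.univ \ T else T) (F := ∅)
    (by
      intro u hu v hv huv
      simp only [Finset.mem_insert, Finset.mem_singleton] at hu hv
      rcases hu with rfl | rfl <;> rcases hv with rfl | rfl
      · exact absurd rfl huv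
      · simpa [hT.adj.ne'] using Finset.sdiff_disjoint
      · simpa [hT.adj.ne'] using Finset.disjoint_sdiff
      · exact absurd rfl huv) (by simp) (by simp)
  rw [Finset.sum_pair hT.adj.ne, if_pos rfl, if_neg hT.adj.ne', Finset.card_empty] at hn
  have h4 := hT.maxCover_erase (Finset.subset_univ T)
  have h5 := G.maxCover_erase_add_gain Finset.univ z
  have h6 := G.maxCover_erase_add_gain T y
  exact h3.of_le (by omega) (by omega)

/-- If another branch has positive gain, split there: the branch of `y` gives `z` positive gain in
the rest. Otherwise all branches have gain 0, and `maxCover_erase_add_card_le` supplies as many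
extra cover vertices as `z` has neighbours. -/
theorem hasBoundedSystem_of_gain_branch_eq_zero {z y : V}
    (ih : ∀ H < G, ∀ x, HasBoundedSystem K H x)
    (hz : ∀ (u : V) (c : G.Walk u u), c.IsCycle → z ∉ c.support) (hzy : G.Adj z y)
    (hg : G.gain (G.branch z y) y = 0) : HasBoundedSystem K G z := by
  have hbr := fun x (hx : G.Adj z x) => isBranch_branch hz hx
  by_cases hx : ∃ x, G.Adj z x ∧ 0 < G.gain (G.branch z x) x
  · obtain ⟨x, hzx, hgx⟩ := hx
    have hxy : x ≠ y := by
      rintro rfl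
      omega
    have hsub : G.branch z y ⊆ Finset.univ \ G.branch z x := by
      rw [Finset.subset_sdiff]
      exact ⟨Finset.subset_univ _, ((hbr x hzx).disjoint_branch (hbr y hzy) hxy).symm⟩
    have h1 := (hbr y hzy).gain_pos hsub (by simp [(hbr x hzx).notMem]) hg
    exact (hbr x hzx).hasBoundedSystem ih
      ((hbr x hzx).le_maxCover (Finset.subset_univ _) (Finset.mem_univ z) (by omega))
  · push Not at hx
    have hT := hbr y hzy
    refine hT.hasBoundedSystem ih ?_
    by_cases h1 : G.gain (Finset.univ \ G.branch z y) z = 1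
    swap
    · exact hT.le_maxCover (Finset.subset_univ _) (Finset.mem_univ z) (by omega)
    have hcard := maxCover_erase_add_card_le (G := G) (z := z) (T := G.branch z)
      (fun x hx => (hbr x hx).mem) (fun x hx => (hbr x hx).notMem)
      (fun x hx x' hx' hxx' => (hbr x hx).disjoint_branch (hbr x' hx') hxx')
      (fun x hx => (hbr x hx).cross) fun x hzx => Nat.le_zero.1 (hx x hzx)
    -- With `y` as only neighbour, `z` would be isolated in the rest and have gain 0 there.
    have h2 : 2 ≤ (Finset.univ.filter (G.Adj z)).card := by
      by_contra! hlt
      have huniq : ∀ x, G.Adj z x → x = y := fun x hzx =>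
        Finset.card_le_one.1 (Nat.le_of_lt_succ hlt) x (by simp [hzx]) y (by simp [hzy])
      have h3 : G.maxCover (Finset.univ \ G.branch z y) =
          G.maxCover ((Finset.univ \ G.branch z y).erase z) := by
        have h4 := maxCover_union (G := G) (X := {z}) (Y := (Finset.univ \ G.branch z y).erase z)
          (by simp) (by
            intro a ha b hb hab
            rw [Finset.mem_singleton] at ha
            subst ha
            rw [huniq b hab] at hb
            simp [hT.mem] at hb)
        rw [maxCover_eq_zero (W := {z}) (by simp), zero_add] at h4
        rw [← h4]
        congr 1
        ext x
        have := hT.notMem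
        by_cases hxz : x = z
        · subst hxz
          simp [this]
        · simp [hxz]
      unfold gain at h1
      omega
    have h4 := hT.maxCover_erase (Finset.subset_univ _)
    have h5 := G.maxCover_erase_add_gain (G.branch z y) y
    omega

theorem hasBoundedSystem_of_mem_cycle (hG : G.CyclesMeetOnce)
    (ih : ∀ H < G, ∀ x, HasBoundedSystem K H x) {z : V} {c : G.Walk z z} (hc : c.IsCycle) :
    HasBoundedSystem K G z := by
  obtain ⟨A, hmem, hdisj, hcover, hcross⟩ := hG.exists_parts hc
  have hcE : c.edges.toFinset ∈ G.cycleEdgeSets := mem_cycleEdgeSets.2 ⟨z, c, hc, rfl⟩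
  have hmz := G.maxCover_erase_add_gain Finset.univ z
  have hzA : ∀ v ∈ c.support, v ≠ z → z ∉ A v := fun v hv hvz h =>
    Finset.disjoint_left.1 (hdisj v hv z c.start_mem_support hvz) h (hmem z c.start_mem_support)
  have hout : ∀ v ∈ c.support, ∀ x ∈ A v, ∀ y ∉ A v, G.Adj x y → x = v ∧ s(v, y) ∈ c.edges := by
    intro v hv x hx y hy hxy
    obtain ⟨w, hw, hyw⟩ := hcover y
    have hvw : v ≠ w := fun h => hy (h ▸ hyw)
    obtain ⟨rfl, -, he⟩ := hcross v hv w hw hvw x hx y hyw hxy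
    exact ⟨rfl, he⟩
  by_cases hsmall : ∃ v ∈ c.support, G.gain (A v) v ≤ 1
  -- A vertex of gain 0 is preferred; failing that, all gains are positive, in particular the one at
  -- the other cycle neighbour `a'`.
  · obtain ⟨v, hv, hgv⟩ : ∃ v ∈ c.support, G.gain (A v) v = 0 ∨
        G.gain (A v) v ≤ 1 ∧ ∀ w ∈ c.support, 0 < G.gain (A w) w := by
      by_cases h0 : ∃ v ∈ c.support, G.gain (A v) v = 0
      · obtain ⟨v, hv, h⟩ := h0
        exact ⟨v, hv, .inl h⟩
      · push Not at h0
        obtain ⟨v, hv, h⟩ := hsmall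
        exact ⟨v, hv, .inr ⟨h, fun w hw => Nat.pos_of_ne_zero (h0 w hw)⟩⟩
    obtain ⟨b, a', hba', hN⟩ := Set.ncard_eq_two.1 (hc.ncard_neighborSet_toSubgraph_eq_two hv)
    have hN' : ∀ y, s(v, y) ∈ c.edges ↔ y = b ∨ y = a' := by
      intro y
      rw [← Walk.mem_edges_toSubgraph, Subgraph.mem_edgeSet, ← Subgraph.mem_neighborSet, hN]
      simp
    have hbe := (hN' b).2 (.inl rfl)
    have ha'e := (hN' a').2 (.inr rfl)
    have hvb : G.Adj v b := c.adj_of_mem_edges hbe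
    have hva' : G.Adj v a' := c.adj_of_mem_edges ha'e
    have hb := c.snd_mem_support_of_mem_edges hbe
    have ha' := c.snd_mem_support_of_mem_edges ha'e
    have hdel : ∀ W : Finset V, (∀ w ∈ c.support, w ∈ W → A w ⊆ W) →
        (G.deleteEdges {s(v, b)}).maxCover W ≤ G.maxCover W := fun W hW =>
      maxCover_deleteEdge_le (hmem v hv) (fun h => Finset.disjoint_left.1
        (hdisj v hv b hb hvb.ne) h (hmem b hb)) hvb (hmem a' ha')
        (fun x hx y hy hxy => ⟨(hout v hv x hx y hy hxy).1,
          (hN' y).1 (hout v hv x hx y hy hxy).2⟩)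
        (fun x hx y hy hxy => (hout a' ha' x hx y hy hxy).1) (hW v hv) (hW a' ha')
        (hgv.imp_right fun h => ⟨h.1, h.2 a' ha'⟩)
    have h1 := hdel Finset.univ (by simp)
    have h2 := hdel (Finset.univ.erase z) (by
      intro w hw hwz x hx
      simp only [Finset.mem_erase, Finset.mem_univ, and_true] at hwz ⊢
      rintro rfl
      exact hzA w hw hwz hx)
    have hn : (G.deleteEdges {s(v, b)}).cycleEdgeSets.card < G.cycleEdgeSets.card := by
      refine Finset.card_lt_card ((Finset.ssubset_iff_of_subset
        (cycleEdgeSets_mono (G.deleteEdges_le _))).2 ⟨_, hcE, fun h => ?_⟩)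
      have := adj_of_mem_cycleEdgeSets h (List.mem_toFinset.2 hbe)
      simp [deleteEdges_adj] at this
    -- The generator for the deleted edge is paid for by the lost cycle.
    have h3 := (ih _ (deleteEdge_lt hvb) z).of_deleteEdge hvb
    have h4 := (G.deleteEdges {s(v, b)}).maxCover_erase_add_gain Finset.univ z
    exact h3.of_le (by omega) (by omega)
  push Not at hsmall
  let D := c.support.toFinset
  have hD : ∀ x, x ∈ D ↔ x ∈ c.support := by simp [D]
  have hzD : z ∈ D := (hD z).2 c.start_mem_support
  have hAlt : ∀ v ∈ D, G.on (A v) < G := by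
    intro v hv
    have hv' := (hD v).1 hv
    obtain ⟨b, a', hba', hN⟩ := Set.ncard_eq_two.1 (hc.ncard_neighborSet_toSubgraph_eq_two hv')
    have hbe : s(v, b) ∈ c.edges := by
      rw [← Walk.mem_edges_toSubgraph, Subgraph.mem_edgeSet, ← Subgraph.mem_neighborSet, hN]
      simp
    have hvb := c.adj_of_mem_edges hbe
    have hb := c.snd_mem_support_of_mem_edges hbe
    exact on_lt hvb fun h => Finset.disjoint_left.1 (hdisj v hv' b hb hvb.ne) h.2 (hmem b hb)
  have hsys := fun v hv => (ih _ (hAlt v hv) v).on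
  have hn := sum_card_cycleEdgeSets_on (G := G) (D := D) (A := A) (F := {c.edges.toFinset})
    (fun u hu v hv => hdisj u ((hD u).1 hu) v ((hD v).1 hv)) (by simpa using hcE) (by
      intro v hv E hE hEv
      rw [Finset.mem_singleton] at hE
      subst hE
      obtain ⟨x, y, he, hxy⟩ := exists_adj_of_mem_cycleEdgeSets hEv
      rw [List.mem_toFinset] at he
      have huniq : ∀ x ∈ c.support, x ∈ A v → x = v := by
        intro x hx hxv
        by_contra hne
        exact Finset.disjoint_left.1 (hdisj x hx v ((hD v).1 hv) hne) (hmem x hx) hxv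
      exact hxy.1.ne ((huniq x (c.fst_mem_support_of_mem_edges he) hxy.2.1).trans
        (huniq y (c.snd_mem_support_of_mem_edges he) hxy.2.2).symm))
  rw [Finset.card_singleton] at hn
  -- The weight counts what remains of the second lists once each part has given one element to the
  -- walk sums.
  let w : Finset V → ℕ := fun Y => ∑ v ∈ Y, (G.gain (A v) v - 1)
  have hmax : ∀ D' : Finset V, ∃ Y ⊆ D', (∀ x ∈ Y, ∀ y ∈ Y, s(x, y) ∉ c.edges) ∧
      ∀ Y' ⊆ D', (∀ x ∈ Y', ∀ y ∈ Y', s(x, y) ∉ c.edges) → w Y' ≤ w Y := by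
    intro D'
    obtain ⟨Y, hY, hYmax⟩ := Finset.exists_max_image
      (D'.powerset.filter fun Y => ∀ x ∈ Y, ∀ y ∈ Y, s(x, y) ∉ c.edges) w ⟨∅, by simp⟩
    simp only [Finset.mem_filter, Finset.mem_powerset] at hY hYmax
    exact ⟨Y, hY.1, hY.2, fun Y' h1 h2 => hYmax Y' ⟨h1, h2⟩⟩
  have hindep : ∀ Y ⊆ D, (∀ x ∈ Y, ∀ y ∈ Y, s(x, y) ∉ c.edges) →
      ∀ x ∈ Y, ∀ y ∈ Y, ¬ G.Adj x y := by
    intro Y hY hYi x hx y hy hxy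
    have hx' := (hD x).1 (hY hx)
    have hy' := (hD y).1 (hY hy)
    exact hYi x hx y hy (hcross x hx' y hy' hxy.ne x (hmem x hx') y (hmem y hy') hxy).2.2
  have hlow : ∀ D' ⊆ D, ∀ Y ⊆ D', (∀ x ∈ Y, ∀ y ∈ Y, s(x, y) ∉ c.edges) →
      ∑ v ∈ D', (G.maxCover ((A v).erase v) + 1) + w Y ≤ G.maxCover (D'.biUnion A) := by
    intro D' hD' Y hY hYi
    have hs : ∀ v ∈ D', v ∈ c.support := fun v hv => (hD v).1 (hD' hv)
    exact maxCover_biUnion_ge (fun v hv => hmem v (hs v hv))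
      (fun u hu v hv => hdisj u (hs u hu) v (hs v hv))
      (fun u hu v hv huv x hx y hy hxy =>
        let h := hcross u (hs u hu) v (hs v hv) huv x hx y hy hxy
        ⟨h.1, h.2.1⟩) (fun v hv => hsmall v (hs v hv)) hY (hindep Y (hY.trans hD') hYi)
  obtain ⟨Y, hY, hYi, hYmax⟩ := hmax D
  obtain ⟨Y', hY', hYi', hYmax'⟩ := hmax (D.erase z)
  have hle : w Y' ≤ w Y := hYmax Y' (hY'.trans (Finset.erase_subset _ _)) hYi'
  have h1 := hlow D subset_rfl Y hY hYi
  have h2 := hlow (D.erase z) (Finset.erase_subset _ _) Y' hY' hYi'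
  have huniv : D.biUnion A = Finset.univ := by
    ext x
    obtain ⟨v, hv, hx⟩ := hcover x
    simp only [Finset.mem_biUnion, Finset.mem_univ, iff_true]
    exact ⟨v, (hD v).2 hv, hx⟩
  have h3 : G.maxCover (Finset.univ.erase z) =
      G.maxCover ((A z).erase z) + G.maxCover ((D.erase z).biUnion A) := by
    rw [← maxCover_union]
    · congr 1
      rw [← huniv]
      ext x
      simp only [Finset.mem_erase, Finset.mem_biUnion, Finset.mem_union]
      constructor
      · rintro ⟨hxz, v, hv, hx⟩
        by_cases hvz : v = z
        · exact .inl ⟨hxz, hvz ▸ hx⟩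
        · exact .inr ⟨v, ⟨hvz, hv⟩, hx⟩
      · rintro (⟨hxz, hx⟩ | ⟨v, ⟨hvz, hv⟩, hx⟩)
        · exact ⟨hxz, z, hzD, hx⟩
        · exact ⟨fun h => hzA v ((hD v).1 hv) hvz (h ▸ hx), v, hv, hx⟩
    · refine Disjoint.mono_left (Finset.erase_subset _ _) ?_
      rw [Finset.disjoint_biUnion_right]
      intro v hv
      obtain ⟨hvz, hv⟩ := Finset.mem_erase.1 hv
      exact hdisj z c.start_mem_support v ((hD v).1 hv) (Ne.symm hvz)
    · intro x hx y hy hxy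
      obtain ⟨hxz, hx⟩ := Finset.mem_erase.1 hx
      obtain ⟨v, hv, hy⟩ := Finset.mem_biUnion.1 hy
      obtain ⟨hvz, hv⟩ := Finset.mem_erase.1 hv
      exact hxz (hcross z c.start_mem_support v ((hD v).1 hv) (Ne.symm hvz) x hx y hy hxy).1
  rw [huniv] at h1
  rw [Finset.sum_add_distrib, Finset.sum_const, smul_eq_mul, mul_one] at h1 h2
  rw [← Finset.add_sum_erase D _ hzD] at h1 hn
  rw [Finset.card_erase_of_mem hzD] at h2
  cases c with
  | nil => exact absurd hc Walk.not_isCycle_nil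
  | @cons _ v _ h p =>
    have hp := ((Walk.cons_isCycle_iff p h).1 hc).1
    have hDp : ∀ x, x ∈ D ↔ x ∈ p.support := by
      intro x
      rw [hD, Walk.support_cons, List.mem_cons]
      exact ⟨fun hx => hx.elim (fun hx => hx ▸ p.end_mem_support) id, .inr⟩
    -- The `p.length + 2` elements spent on the cycle are thus one per cycle vertex plus one, the
    -- latter paid for by the cycle itself.
    have hDcard : D.card = p.length + 1 := by
      rw [← p.length_support, ← List.toFinset_card_of_nodup hp.support_nodup]
      congr 1
      ext x
      rw [hDp, List.mem_toFinset]
    have hfin := HasSystem.cycle (K := K) (h := h) (p := p) (D := D) (A := A) hDp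
      (fun x y hxy => by
        obtain ⟨u, hu, hx⟩ := hcover x
        obtain ⟨v, hv, hy⟩ := hcover y
        by_cases huv : u = v
        · exact .inl ⟨u, (hD u).2 hu, hx, huv ▸ hy⟩
        · exact .inr (hcross u hu v hv huv x hx y hy hxy).2.2) hsys
      (fun Z hZ hZi => hYmax Z hZ hZi)
      (fun Z hZ hzZ hZi => hYmax' Z (fun x hx => Finset.mem_erase.2
        ⟨fun h => hzZ (h ▸ hx), hZ hx⟩) hZi)
    rw [Finset.sum_add_distrib, ← Finset.add_sum_erase D _ hzD,
      ← Finset.add_sum_erase D (fun v => (G.on (A v)).cycleEdgeSets.card) hzD] at hfin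
    exact hfin.of_le (by omega) (by omega)

/-- The critical case is gain 0 at `z` and 1 at `y`. If `z` raises `maxCover` of the whole graph,
that extra vertex suffices. If not, one may pass to `y`, which is on a cycle or sees a branch of
gain 0 towards `z`. -/
theorem hasBoundedSystem_of_adj (hG : G.CyclesMeetOnce)
    (ih : ∀ H < G, ∀ x, HasBoundedSystem K H x) {z y : V} (hzy : G.Adj z y) :
    HasBoundedSystem K G z := by
  have hcyc : ∀ {v u : V} {c : G.Walk u u}, c.IsCycle → v ∈ c.support →
      HasBoundedSystem K G v := fun hc hv =>
    hasBoundedSystem_of_mem_cycle hG ih (hc.rotate hv)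
  by_cases hz : ∀ (u : V) (c : G.Walk u u), c.IsCycle → z ∉ c.support
  swap
  · push Not at hz
    obtain ⟨u, c, hc, hzc⟩ := hz
    exact hcyc hc hzc
  have hT := isBranch_branch hz hzy
  by_cases hg : G.gain (G.branch z y) y = 0
  · exact hasBoundedSystem_of_gain_branch_eq_zero ih hz hzy hg
  by_cases hle : G.gain (Finset.univ \ G.branch z y) z = 0 ∧ G.gain (G.branch z y) y < 2
  swap
  · exact hT.hasBoundedSystem ih
      (hT.le_maxCover (Finset.subset_univ _) (Finset.mem_univ z) (by omega))
  obtain ⟨hg0, hg1⟩ := hle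
  have h1 := hT.maxCover_erase (Finset.subset_univ _)
  have h2 := G.maxCover_erase_add_gain (G.branch z y) y
  by_cases hm : G.maxCover Finset.univ ≤ G.maxCover (Finset.univ.erase z)
  swap
  · refine hT.hasBoundedSystem ih ?_
    omega
  refine HasBoundedSystem.change_vertex (y := y) ?_ hm
  by_cases hy : ∀ (u : V) (c : G.Walk u u), c.IsCycle → y ∉ c.support
  swap
  · push Not at hy
    obtain ⟨u, c, hc, hyc⟩ := hy
    exact hcyc hc hyc
  refine hasBoundedSystem_of_gain_branch_eq_zero ih hy hzy.symm ?_
  have hT' := isBranch_branch hy hzy.symm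
  have hdT : Disjoint (G.branch y z) (G.branch z y) := by
    rw [Finset.disjoint_left]
    intro w hw hw'
    have h3 := (Finset.mem_filter.1 hw).2
    have h4 := (Finset.mem_filter.1 hw').2
    rw [Sym2.eq_swap] at h3
    exact hT.notMem (by simpa [branch] using h4.trans h3.symm)
  have hsub : G.branch y z ⊆ Finset.univ \ G.branch z y :=
    Finset.subset_sdiff.2 ⟨Finset.subset_univ _, hdT⟩
  have hcr : ∀ a ∈ G.branch y z, ∀ b ∈ (Finset.univ \ G.branch z y) \ G.branch y z,
      ¬ G.Adj a b := by
    intro a ha b hb hab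
    simp only [Finset.mem_sdiff] at hb
    exact hb.1.2 ((hT'.cross a ha b hb.2 hab).2 ▸ hT.mem)
  -- Away from the branch of `y`, the branch of `z` is joined to nothing else, so `z` has the same
  -- gain in that branch as in the whole complement.
  have h3 := maxCover_union Finset.disjoint_sdiff hcr
  have h4 := maxCover_union (G := G) (X := (G.branch y z).erase z)
    (Finset.disjoint_sdiff.mono_left (Finset.erase_subset _ _))
    fun a ha => hcr a (Finset.mem_of_mem_erase ha)
  rw [Finset.union_sdiff_of_subset hsub] at h3
  have h5 : (G.branch y z).erase z ∪ ((Finset.univ \ G.branch z y) \ G.branch y z) =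
      (Finset.univ \ G.branch z y).erase z := by
    ext x
    have h6 := @hsub x
    have h7 : x = z → x ∈ G.branch y z := fun h => h ▸ hT'.mem
    simp only [Finset.mem_union, Finset.mem_erase, Finset.mem_sdiff] at h6 ⊢
    tauto
  rw [h5] at h4
  unfold gain at hg0 ⊢
  omega

theorem CyclesMeetOnce.hasBoundedSystem (hG : G.CyclesMeetOnce) (z : V) :
    HasBoundedSystem K G z := by
  induction G using WellFoundedLT.induction generalizing z with
  | _ G ih =>
    have ih' : ∀ H < G, ∀ x, HasBoundedSystem K H x := fun H hH => ih H hH (hG.mono hH.le)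
    by_cases hz : ∃ y, G.Adj z y
    · obtain ⟨y, hzy⟩ := hz
      exact hasBoundedSystem_of_adj hG ih' hzy
    push Not at hz
    by_cases hne : ∃ x y, G.Adj x y
    swap
    · push Not at hne
      obtain rfl : G = ⊥ := by
        ext x y
        simp [hne]
      exact hasSystem_bot _ _ _
    obtain ⟨x, y, hxy⟩ := hne
    -- An isolated `z` has gain 0, so the system of a non-isolated vertex can be taken.
    refine (hasBoundedSystem_of_adj hG ih' hxy).change_vertex ?_
    have := maxCover_union (G := G) (X := {z}) (Y := Finset.univ.erase z) (by simp) (by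
      intro a ha b _
      rw [Finset.mem_singleton] at ha
      exact ha ▸ hz b)
    rw [maxCover_eq_zero (W := {z}) (by simp), zero_add] at this
    rw [← this]
    apply le_of_eq
    congr 1
    ext x
    simp

end Induction

end SimpleGraph

/-! ### The bound on the arithmetical rank -/

theorem theorem3p5 (K : Type*) [Field K] {V : Type*} [Finite V] (G : SimpleGraph V)
    (hG : G.IsCactus) (n : ℕ) (hn : G.cycleSubgraphs.ncard = n) :
    (G.edgeIdeal K).arithmeticalRank ≤ (G.edgeIdeal K).bigHeight + (n : ℕ∞) := by
  classical
  have := Fintype.ofFinite V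
  have key : ∃ L : List (MvPolynomial V K), L.length ≤ G.maxCover Finset.univ + n ∧
      (∀ f ∈ L, f ∈ G.edgeIdeal K) ∧
      ∀ P : Ideal (MvPolynomial V K), P.IsPrime → (∀ f ∈ L, f ∈ P) → G.edgeIdeal K ≤ P := by
    rcases isEmpty_or_nonempty V with hV | ⟨⟨z⟩⟩
    · exact ⟨[], by simp, by simp, fun P _ _ => (SimpleGraph.edgeIdeal_le_iff K).2 fun x =>
        hV.elim x⟩
    · obtain ⟨A, B, hA, hB, hI, -, hP⟩ := hG.cyclesMeetOnce.hasBoundedSystem (K := K) z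
      refine ⟨A ++ B, ?_, hI, hP⟩
      have h1 := G.maxCover_erase_add_gain Finset.univ z
      have h2 := G.card_cycleEdgeSets_le
      rw [List.length_append]
      omega
  obtain ⟨L, hL, hI, hP⟩ := key
  obtain ⟨S, hS, hc⟩ := G.exists_isMaxIndep_card Finset.univ
  have hb : (G.maxCover Finset.univ : ℕ∞) ≤ (G.edgeIdeal K).bigHeight := by
    rw [← hc]
    refine SimpleGraph.card_le_bigHeight_edgeIdeal (fun x y hxy => ?_) fun x hx => ?_
    · simp only [Finset.mem_sdiff, Finset.mem_univ, true_and]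
      by_contra! h
      exact hS.2.1 x h.1 y h.2 hxy
    · obtain ⟨y, hy, hxy⟩ := hS.2.2 x (Finset.mem_univ x) (by simpa using hx)
      exact ⟨y, by simp [hy], hxy⟩
  calc (G.edgeIdeal K).arithmeticalRank ≤ (L.length : ℕ∞) :=
        SimpleGraph.arithmeticalRank_edgeIdeal_le hI hP
    _ ≤ ((G.maxCover Finset.univ + n : ℕ) : ℕ∞) := by exact_mod_cast hL
    _ = (G.maxCover Finset.univ : ℕ∞) + n := by push_cast; rfl
    _ ≤ _ := by gcongr
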